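/- Let $\mu>0$, $\alpha=\min(2,\mu)$, $p>1+\frac{2}{\alpha}$, and let $f(y)=|y|^p$ or $f(y)=|y|^{p-1}y$ $(y\in\mathbb R)$. Let $\eta\in(0,2)$ and put $\alpha_0=\mu$ if $\mu<2$, $\alpha_0=2-\eta$ if $\mu=2$, and $\alpha_0=2$ if $\mu>2$. Consider, for real-valued $u$, the one-dimensional Cauchy problem $$\partial_t^2u-\partial_x^2u+\frac{\mu}{1+t}\,\partial_tu=f(\partial_tu)\quad(x\in\mathbb R,\ t>0),\qquad u(0)=u_0,\quad \partial_tu(0)=u_1,\tag{$*$}$$ and write $\|g\|_{H^k}=\sum_{\ell=0}^k\|\partial_x^\ell g\|_{L^2(\mathbb R)}$. For $0\le s\le t$ and $(w_0,w_1)\in H^2(\mathbb R)\times H^1(\mathbb R)$ let $R(t,s)(w_0,w_1)=w(t)$, where $w\in C([s,\infty),H^2)\cap C^1([s,\infty),H^1)\cap C^2([s,\infty),L^2)$ is the strong solution of $\partial_t^2w-\partial_x^2w+\frac{\mu}{1+t}\partial_tw=0$ with $w(s)=w_0$, $\partial_tw(s)=w_1$, and let $S(t,s)g=R(t,s)(0,g)$.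 A global mild solution of $(*)$ is a function $u\in C^1([0,\infty),H^1(\mathbb R))$ with $u(0)=u_0$, $\partial_tu(0)=u_1$ and $$u(t)=R(t,0)(u_0,u_1)+\int_0^tS(t,s)f(\partial_tu(s))\,ds\quad\text{in }H^1(\mathbb R),\ \text{for all }t\ge0.$$ Then there are constants $\varepsilon_0>0$ and $C>0$, depending only on $\mu,p,\eta$ and $f$, such that for all $u_0\in H^2(\mathbb R)$, $u_1\in H^1(\mathbb R)$ with $\|u_0\|_{H^2}+\|u_1\|_{H^1}\le\varepsilon_0$ the problem $(*)$ has a unique global mild solution $u$; it satisfies $$u\in C([0,\infty),H^2(\mathbb R))\cap C^1([0,\infty),H^1(\mathbb R))\cap C^2([0,\infty),L^2(\mathbb R))$$ and, for all $t\ge0$, $$(1+t)^{-1}\|u(t)\|_{L^2}+\|\partial_xu(t)\|_{H^1}+\|\partial_tu(t)\|_{H^1}\le C(1+t)^{-\alpha_0/2}.$$ -/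

import Mathlib

open MeasureTheory Set
open scoped ContDiff

noncomputable section

namespace DampedWave

/-- The real Hilbert space `L²(ℝ)`. -/
abbrev L2 : Type := Lp ℝ 2 (volume : Measure ℝ)

/-- `g` is the weak derivative of `f` on the real line (both in `L²(ℝ)`). -/
def HasWeakDeriv (f g : L2) : Prop :=
  ∀ φ : ℝ → ℝ, ContDiff ℝ ∞ φ → HasCompactSupport φ →
    ∫ x, f x * deriv φ x = -∫ x, g x * φ x

/-- A continuous compactly supported function, as an element of `L²(ℝ)`. -/
def testL2 (φ : ℝ → ℝ) (h : Continuous φ) (hc : HasCompactSupport φ) : L2 :=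
  (h.memLp_of_hasCompactSupport (μ := volume) (p := 2) hc).toLp φ

theorem integral_mul_eq_inner (f : L2) (φ : ℝ → ℝ) (h : Continuous φ)
    (hc : HasCompactSupport φ) :
    ∫ x, f x * φ x = inner ℝ (testL2 φ h hc) f := by
  rw [L2.inner_def]
  refine integral_congr_ae ?_
  filter_upwards [(h.memLp_of_hasCompactSupport (μ := volume) (p := 2) hc).coeFn_toLp]
    with x hx
  simp only [testL2, hx]
  simp

/-- The weak derivative relation, tested through the inner product of `L²(ℝ)`. -/
theorem hasWeakDeriv_iff (f g : L2) :
    HasWeakDeriv f g ↔ ∀ (φ : ℝ → ℝ) (h : ContDiff ℝ ∞ φ) (hc : HasCompactSupport φ),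
      inner ℝ (testL2 (deriv φ) (h.continuous_deriv (by simp)) hc.deriv) f =
        -inner ℝ (testL2 φ h.continuous hc) g := by
  unfold HasWeakDeriv
  refine forall_congr' fun φ => forall_congr' fun h => forall_congr' fun hc => ?_
  rw [integral_mul_eq_inner f _ (h.continuous_deriv (by simp)) hc.deriv,
    integral_mul_eq_inner g _ h.continuous hc]

/-- The Sobolev space `H^k(ℝ)`. An element is a function of `L²(ℝ)` together with its
(uniquely determined) weak derivatives: `F i` is the `i`-th weak derivative of `F 0`. The norm
inherited from `PiLp 1` is `‖F‖ = ∑_{i ≤ k} ‖∂ₓⁱ F‖_{L²}`. -/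
def Sobolev (k : ℕ) : Submodule ℝ (PiLp 1 (fun _ : Fin (k + 1) => L2)) where
  carrier := {F | ∀ i : Fin k, HasWeakDeriv (F i.castSucc) (F i.succ)}
  zero_mem' := by
    intro i
    rw [hasWeakDeriv_iff]
    intro φ h hc
    simp
  add_mem' := by
    intro F G hF hG i
    have h1 := hF i
    have h2 := hG i
    rw [hasWeakDeriv_iff] at h1 h2 ⊢
    intro φ h hc
    simp only [PiLp.add_apply, inner_add_right, h1 φ h hc, h2 φ h hc]
    ring
  smul_mem' := by
    intro c F hF i
    have h1 := hF i
    rw [hasWeakDeriv_iff] at h1 ⊢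
    intro φ h hc
    simp only [PiLp.smul_apply, inner_smul_right, h1 φ h hc]
    ring

theorem Sobolev.norm_eq {k : ℕ} (F : Sobolev k) : ‖F‖ = ∑ i, ‖F.1 i‖ := by
  rw [← PiLp.norm_eq_of_L1]
  rfl

/-- `H^k(ℝ)` is complete, so that Bochner integrals with values in it are meaningful. -/
instance Sobolev.completeSpace (k : ℕ) : CompleteSpace (Sobolev k) := by
  have hcl : IsClosed ((Sobolev k : Submodule ℝ _) :
      Set (PiLp 1 (fun _ : Fin (k + 1) => L2))) := by
    have : ((Sobolev k : Submodule ℝ _) : Set (PiLp 1 (fun _ : Fin (k + 1) => L2))) =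
        ⋂ (i : Fin k) (φ : ℝ → ℝ) (h : ContDiff ℝ ∞ φ) (hc : HasCompactSupport φ),
          {F | inner ℝ (testL2 (deriv φ) (h.continuous_deriv (by simp)) hc.deriv)
            (F i.castSucc) = -inner ℝ (testL2 φ h.continuous hc) (F i.succ)} := by
      ext F
      simp only [mem_iInter, mem_ofPred_eq, SetLike.mem_coe]
      exact forall_congr' fun i => hasWeakDeriv_iff _ _
    rw [this]
    refine isClosed_iInter fun i => isClosed_iInter fun φ => isClosed_iInter fun h =>
      isClosed_iInter fun hc => isClosed_eq ?_ ?_ <;> fun_prop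
  exact hcl.completeSpace_coe

/-- The inclusion `H^k(ℝ) → L²(ℝ)`. -/
def toL2 {k : ℕ} (F : Sobolev k) : L2 := F.1 0

/-- The inclusion `H^{k+1}(ℝ) → H^k(ℝ)`. -/
def incl {k : ℕ} (F : Sobolev (k + 1)) : Sobolev k :=
  ⟨WithLp.toLp 1 fun i => F.1 i.castSucc, fun i => F.2 i.castSucc⟩

/-- The spatial derivative `∂ₓ : H^{k+1}(ℝ) → H^k(ℝ)`. -/
def dx {k : ℕ} (F : Sobolev (k + 1)) : Sobolev k :=
  ⟨WithLp.toLp 1 fun i => F.1 i.succ, fun i => F.2 i.succ⟩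

/-- `w` is a strong solution on `[s, ∞)` of the linear damped wave equation
`∂ₜ²w - ∂ₓ²w + μ/(1+t) ∂ₜw = 0` with data `w(s) = w₀`, `∂ₜw(s) = w₁` prescribed at time `s`:
it lies in `C([s,∞), H²) ∩ C¹([s,∞), H¹) ∩ C²([s,∞), L²)` and the equation holds in `L²(ℝ)`. -/
structure IsStrongSolution (μ s : ℝ) (w₀ : Sobolev 2) (w₁ : Sobolev 1)
    (w : ℝ → Sobolev 2) : Prop where
  continuousOn : ContinuousOn w (Ici s)
  contDiffOn_one : ContDiffOn ℝ 1 (fun t => incl (w t)) (Ici s)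
  contDiffOn_two : ContDiffOn ℝ 2 (fun t => toL2 (w t)) (Ici s)
  initial : w s = w₀
  initial_deriv : derivWithin (fun t => incl (w t)) (Ici s) s = w₁
  equation : ∀ t, s ≤ t →
    iteratedDerivWithin 2 (fun τ => toL2 (w τ)) (Ici s) t - toL2 (dx (dx (w t)))
      + (μ / (1 + t)) • derivWithin (fun τ => toL2 (w τ)) (Ici s) t = 0

open Classical in
/-- The solution operator `R(t,s) : H²(ℝ) × H¹(ℝ) → H²(ℝ)`, `t ≥ s ≥ 0`, of the linear damped
wave equation: the value at time `t` of the strong solution with data `(w₀, w₁)` at time `s`. -/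
def R (μ t s : ℝ) (w₀ : Sobolev 2) (w₁ : Sobolev 1) : Sobolev 2 :=
  if h : ∃ w, IsStrongSolution μ s w₀ w₁ w then h.choose t else 0

/-- `S(t,s) g = R(t,s)(0, g)`. -/
def S (μ t s : ℝ) (g : Sobolev 1) : Sobolev 2 := R μ t s 0 g

/-- `u` is a global mild solution of `∂ₜ²u - ∂ₓ²u + μ/(1+t) ∂ₜu = f(∂ₜu)`, `u(0) = u₀`,
`∂ₜu(0) = u₁`: `u ∈ C¹([0,∞), H¹)` has these data and satisfies
`u(t) = R(t,0)(u₀,u₁) + ∫₀ᵗ S(t,s) f(∂ₜu(s)) ds` in `H¹(ℝ)` (a Bochner integral). Here `N s` is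
the function `f(∂ₜu(s))`, as an element of `H¹(ℝ)`. -/
def IsGlobalMildSolution (μ : ℝ) (f : ℝ → ℝ) (u₀ : Sobolev 2) (u₁ : Sobolev 1)
    (u : ℝ → Sobolev 1) : Prop :=
  ContDiffOn ℝ 1 u (Ici 0) ∧ u 0 = incl u₀ ∧ derivWithin u (Ici 0) 0 = u₁ ∧
  ∃ N : ℝ → Sobolev 1,
    (∀ s, 0 ≤ s → ∀ᵐ x : ℝ, toL2 (N s) x = f (toL2 (derivWithin u (Ici 0) s) x)) ∧
    ∀ t, 0 ≤ t →
      IntervalIntegrable (fun s => incl (S μ t s (N s))) volume 0 t ∧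
      u t = incl (R μ t 0 u₀ u₁) + ∫ s in (0 : ℝ)..t, incl (S μ t s (N s))

/-- The decay exponent: `μ` if `μ < 2`, `2 - η` if `μ = 2`, and `2` if `μ > 2`. -/
def alpha0 (μ η : ℝ) : ℝ := if μ < 2 then μ else if μ = 2 then 2 - η else 2

end DampedWave

end

/-! The linear flow decays with a rate that is uniform in the starting time, and the nonlinear
problem is a small perturbation of it.

Linear decay. For `0 < β ≤ min μ 2`, the energy `½(‖∂ₜw‖² + ‖∂ₓw‖²)`, corrected by multiples of
`(1+t)⁻¹⟨w, ∂ₜw⟩` and `(1+t)⁻²‖w‖²`, becomes nonincreasing after multiplication by `(1+t)^β`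
(`antitoneOn_energy`). It is coercive exactly when `3β/2 < μ + 1`. This allows `β = μ` for `μ < 2`
and `β = 2` for `μ > 2`, but excludes `β = μ = 2`, whence the loss `η`. Applying the estimate also
to difference quotients in `x` controls one more derivative (`exists_decayNorm_le`): the weighted
norm at time `t` is at most `K((1+s)/(1+t))^(β/2)` times the one at time `s`.

Linear existence. The Riemann invariants `∂ₜw ± ∂ₓw`, transported back along characteristics,
satisfy an ODE whose generator is bounded and strongly continuous on `H¹ × H¹ × H¹`. Picard
iteration gives an evolution family, and Duhamel's formula solves the forced equation. The
constraint that the slope be `∂ₓw` propagates. Uniqueness of strong solutions identifies `R` and `S`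
with this family (`R_eq`).

Nonlinear problem. The embedding of `H¹` in `L^∞` and `p > 2` make `v ↦ f(v)` locally Lipschitz on
`H¹`, with constant of order `M^(p-1)` on the ball of radius `M`. If `‖v(s)‖` decays like
`(1+s)^(-β/2)`, then `f(v(s))` gains the factor `(1+s)^(-γ)` with `γ = β(p-1)/2`. Choosing `β` with
`γ > 1` makes the Duhamel integral converge, and for small data it is a contraction in the weighted
space (`exists_global`). Uniqueness holds without smallness: every mild solution is the first
component of a solution of a locally Lipschitz ODE.

Weak derivatives enter throughout as derivatives along the translation group of `L²`, from which
integration by parts, the chain rule and the Sobolev embedding are all derived. -/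

noncomputable section

namespace DampedWave

open Filter Topology

/-! ### Translations on `L²(ℝ)`. -/

/-- The translation `f ↦ f(· + h)` on `L²(ℝ)`. -/
def transl (h : ℝ) : L2 →ₗᵢ[ℝ] L2 :=
  Lp.compMeasurePreservingₗᵢ ℝ (fun x => x + h) (measurePreserving_add_right volume h)

theorem coeFn_transl (h : ℝ) (f : L2) : transl h f =ᵐ[volume] fun x => f (x + h) :=
  Lp.coeFn_compMeasurePreserving f (measurePreserving_add_right volume h)

theorem transl_toLp (h : ℝ) {f : ℝ → ℝ} (hf : MemLp f 2 volume) :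
    transl h (hf.toLp f) =
      (hf.comp_measurePreserving (measurePreserving_add_right volume h)).toLp _ :=
  Lp.toLp_compMeasurePreserving hf (measurePreserving_add_right volume h)

@[simp]
theorem transl_zero (f : L2) : transl 0 f = f := by
  apply Lp.ext
  filter_upwards [coeFn_transl 0 f] with x hx
  simp [hx]

theorem transl_add (a b : ℝ) (f : L2) : transl (a + b) f = transl a (transl b f) := by
  apply Lp.ext
  have h1 := (measurePreserving_add_right (volume : Measure ℝ) a).quasiMeasurePreserving.ae
    (coeFn_transl b f)
  filter_upwards [coeFn_transl (a + b) f, coeFn_transl a (transl b f), h1] with x hx hx1 hx2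
  rw [hx, hx1, hx2, add_assoc]

@[simp]
theorem transl_neg_transl (h : ℝ) (f : L2) : transl (-h) (transl h f) = f := by
  rw [← transl_add]; simp

@[simp]
theorem transl_transl_neg (h : ℝ) (f : L2) : transl h (transl (-h) f) = f := by
  rw [← transl_add]; simp

theorem continuous_transl {Z : Type*} [TopologicalSpace Z] {h : Z → ℝ} {f : Z → L2}
    (hh : Continuous h) (hf : Continuous f) : Continuous fun z => transl (h z) (f z) := by
  let g : Z → C(ℝ, ℝ) := fun z => ⟨fun x => x + h z, by fun_prop⟩
  have hg : Continuous g := by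
    apply ContinuousMap.continuous_of_continuous_uncurry
    exact continuous_snd.add (hh.comp continuous_fst)
  exact hf.compMeasurePreservingLp hg (fun z => measurePreserving_add_right volume (h z))
    (by simp)

theorem inner_transl_left (h : ℝ) (f g : L2) :
    inner ℝ (transl h f) g = inner ℝ f (transl (-h) g) := by
  rw [← (transl (-h)).inner_map_map, transl_neg_transl]

theorem inner_transl_right (h : ℝ) (f g : L2) :
    inner ℝ f (transl h g) = inner ℝ (transl (-h) f) g := by
  rw [inner_transl_left, neg_neg]

theorem hasCompactSupport_comp_add (h : ℝ) {φ : ℝ → ℝ} (hc : HasCompactSupport φ) :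
    HasCompactSupport fun x => φ (x + h) :=
  hc.comp_homeomorph (Homeomorph.addRight h)

theorem transl_testL2 (h : ℝ) (φ : ℝ → ℝ) (hφ : Continuous φ) (hc : HasCompactSupport φ) :
    transl h (testL2 φ hφ hc) =
      testL2 (fun x => φ (x + h)) (by fun_prop) (hasCompactSupport_comp_add h hc) :=
  transl_toLp h _

/-! ### Weak derivatives as derivatives along translations. -/

theorem eq_of_forall_inner_testL2 {f g : L2}
    (H : ∀ (φ : ℝ → ℝ) (h : ContDiff ℝ ∞ φ) (hc : HasCompactSupport φ),
      inner ℝ (testL2 φ h.continuous hc) f = inner ℝ (testL2 φ h.continuous hc) g) : f = g := by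
  have hloc : ∀ k : L2, LocallyIntegrable k volume := fun k =>
    (Lp.memLp k).locallyIntegrable (by norm_num)
  apply Lp.ext
  apply ae_eq_of_integral_contDiff_smul_eq (hloc f) (hloc g)
  intro φ h hc
  have := H φ h hc
  rw [← integral_mul_eq_inner, ← integral_mul_eq_inner] at this
  simpa [mul_comm] using this

theorem HasWeakDeriv.transl {a g : L2} (H : HasWeakDeriv a g) (s : ℝ) :
    HasWeakDeriv (transl s a) (transl s g) := by
  rw [hasWeakDeriv_iff] at H ⊢
  intro φ h hc
  have := H (fun x => φ (x + -s)) (h.comp (contDiff_id.add contDiff_const))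
    (hasCompactSupport_comp_add _ hc)
  rw [inner_transl_right, inner_transl_right, transl_testL2, transl_testL2, ← this]
  congr 2
  ext x
  exact (deriv_comp_add_const φ (-s) x).symm

-- The pairing is the convolution of `a` with the reflected test function, so the derivative falls
-- on the smooth factor and no regularity of `a` is needed.
open Convolution in
theorem hasDerivAt_inner_transl (a : L2) (φ : ℝ → ℝ) (h : ContDiff ℝ ∞ φ)
    (hc : HasCompactSupport φ) :
    HasDerivAt (fun s => inner ℝ (testL2 φ h.continuous hc) (transl s a))
      (-inner ℝ (testL2 (deriv φ) (h.continuous_deriv (by simp)) hc.deriv) a) 0 := by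
  have hloc : LocallyIntegrable a volume := (Lp.memLp a).locallyIntegrable (by norm_num)
  have hψ : ContDiff ℝ 1 fun x => φ (-x) := (h.comp contDiff_neg).of_le (by simp)
  have hψc : HasCompactSupport fun x => φ (-x) := hc.comp_homeomorph (Homeomorph.neg ℝ)
  have key := hψc.hasDerivAt_convolution_right (ContinuousLinearMap.mul ℝ ℝ) hloc hψ 0
  have e : (fun s => inner ℝ (testL2 φ h.continuous hc) (transl s a)) =
      (a ⋆[ContinuousLinearMap.mul ℝ ℝ, volume] fun x => φ (-x)) := by
    ext s
    rw [inner_transl_right, transl_testL2, ← integral_mul_eq_inner]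
    simp only [convolution, ContinuousLinearMap.mul_apply']
    congr 1; ext x; congr 2; ring
  have e' : (-inner ℝ (testL2 (deriv φ) (h.continuous_deriv (by simp)) hc.deriv) a) =
      (a ⋆[ContinuousLinearMap.mul ℝ ℝ, volume] deriv fun x => φ (-x)) 0 := by
    rw [← integral_mul_eq_inner, ← integral_neg]
    simp only [convolution, ContinuousLinearMap.mul_apply']
    congr 1; ext x
    have := deriv_comp_neg φ (0 - x)
    rw [this]; simp
  rw [e, e']
  exact key

theorem HasWeakDeriv.hasDerivAt_inner {a g : L2} (H : HasWeakDeriv a g) (φ : ℝ → ℝ)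
    (h : ContDiff ℝ ∞ φ) (hc : HasCompactSupport φ) (s : ℝ) :
    HasDerivAt (fun s => inner ℝ (testL2 φ h.continuous hc) (DampedWave.transl s a))
      (inner ℝ (testL2 φ h.continuous hc) (DampedWave.transl s g)) s := by
  have h1 := hasDerivAt_inner_transl (DampedWave.transl s a) φ h hc
  rw [(hasWeakDeriv_iff _ _).1 (H.transl s) φ h hc, neg_neg] at h1
  have h2 := HasDerivAt.comp_sub_const (x := s) (a := s) (f := fun r => inner ℝ
    (testL2 φ h.continuous hc) (DampedWave.transl r (DampedWave.transl s a))) (by simpa using h1)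
  simpa [← transl_add] using h2

theorem HasWeakDeriv.transl_sub_eq_integral {a g : L2} (H : HasWeakDeriv a g) (h : ℝ) :
    DampedWave.transl h a - a = ∫ s in (0 : ℝ)..h, DampedWave.transl s g := by
  have hcont : Continuous fun s => DampedWave.transl s g :=
    continuous_transl continuous_id continuous_const
  apply eq_of_forall_inner_testL2
  intro φ hφ hc
  have h1 : ∫ s in (0 : ℝ)..h, inner ℝ (testL2 φ hφ.continuous hc) (DampedWave.transl s g) = _ :=
    intervalIntegral.integral_eq_sub_of_hasDerivAt
      (fun s _ => H.hasDerivAt_inner φ hφ hc s)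
      ((continuous_const.inner hcont).intervalIntegrable (μ := volume) _ _)
  have h2 := (innerSL ℝ (testL2 φ hφ.continuous hc)).intervalIntegral_comp_comm
    (hcont.intervalIntegrable (μ := volume) 0 h)
  simp only [innerSL_apply_apply] at h2
  rw [← h2, h1, inner_sub_right, transl_zero]

/-- The integral formula for `transl h a - a`, obtained by testing, has an integrand continuous in
`L²`; the fundamental theorem of calculus therefore upgrades weak differentiability to
differentiability in norm. -/
theorem HasWeakDeriv.hasDerivAt {a g : L2} (H : HasWeakDeriv a g) (s : ℝ) :
    HasDerivAt (fun h => DampedWave.transl h a) (DampedWave.transl s g) s := by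
  have hcont : Continuous fun s => DampedWave.transl s g :=
    continuous_transl continuous_id continuous_const
  have h1 := (hcont.integral_hasStrictDerivAt 0 s).hasDerivAt.add_const a
  refine h1.congr_of_eventuallyEq (Eventually.of_forall fun h => ?_)
  have := H.transl_sub_eq_integral h
  simp [← this]

theorem hasWeakDeriv_of_hasDerivAt {a g : L2} (H : HasDerivAt (fun h => transl h a) g 0) :
    HasWeakDeriv a g := by
  rw [hasWeakDeriv_iff]
  intro φ h hc
  have h1 := (innerSL ℝ (testL2 φ h.continuous hc)).hasFDerivAt.comp_hasDerivAt 0 H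
  have h2 := h1.unique (hasDerivAt_inner_transl a φ h hc)
  simp only [innerSL_apply_apply] at h2
  rw [h2, neg_neg]

theorem HasWeakDeriv.unique {a g g' : L2} (H : HasWeakDeriv a g) (H' : HasWeakDeriv a g') :
    g = g' := by
  simpa using (H.hasDerivAt 0).unique (H'.hasDerivAt 0)

/-- Integration by parts: translations are isometries, so `⟨transl t a, transl t b⟩` is constant,
and its derivative at `0` vanishes. -/
theorem HasWeakDeriv.inner_add_inner {a a' b b' : L2} (ha : HasWeakDeriv a a')
    (hb : HasWeakDeriv b b') : inner ℝ a' b + inner ℝ a b' = 0 := by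
  have h1 := (ha.hasDerivAt 0).inner ℝ (hb.hasDerivAt 0)
  have h2 : (fun t => inner ℝ (DampedWave.transl t a) (DampedWave.transl t b)) =
      fun _ => inner ℝ a b := by
    ext t; exact (DampedWave.transl t).inner_map_map _ _
  rw [h2] at h1
  have := h1.unique (hasDerivAt_const 0 _)
  simp only [transl_zero] at this
  linarith

theorem HasWeakDeriv.norm_transl_sub_le {a g : L2} (H : HasWeakDeriv a g) (h : ℝ) :
    ‖DampedWave.transl h a - a‖ ≤ |h| * ‖g‖ := by
  rw [H.transl_sub_eq_integral]
  have := intervalIntegral.norm_integral_le_of_norm_le_const (a := 0) (b := h)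
    (f := fun s => DampedWave.transl s g) (C := ‖g‖) (fun s _ => (by simp))
  simpa [mul_comm] using this

/-! ### The Sobolev embedding. -/

/-- After exchanging the integrals, the mean of `|b|` over a unit interval is at most its `L²` norm
there, because that interval has measure one. -/
theorem lintegral_enorm_transl_le (b : L2) (A : Set ℝ) :
    ∫⁻ s in Icc (0 : ℝ) 1, ∫⁻ x in A, ‖b (x + s)‖ₑ ≤ ‖b‖ₑ * volume A := by
  have hb : Measurable b := (Lp.stronglyMeasurable b).measurable
  rw [lintegral_lintegral_swap (by fun_prop)]
  have hprob : IsProbabilityMeasure (volume.restrict (Icc (0 : ℝ) 1)) :=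
    ⟨by simp [Measure.restrict_apply MeasurableSet.univ]⟩
  have key : ∀ x : ℝ, ∫⁻ s in Icc (0 : ℝ) 1, ‖b (x + s)‖ₑ ≤ ‖b‖ₑ := by
    intro x
    have hm : AEStronglyMeasurable (fun s => b (x + s)) (volume.restrict (Icc (0 : ℝ) 1)) :=
      (by fun_prop : Measurable fun s => b (x + s)).aestronglyMeasurable
    calc ∫⁻ s in Icc (0 : ℝ) 1, ‖b (x + s)‖ₑ
        = eLpNorm (fun s => b (x + s)) 1 (volume.restrict (Icc (0 : ℝ) 1)) :=
          eLpNorm_one_eq_lintegral_enorm.symm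
      _ ≤ eLpNorm (fun s => b (x + s)) 2 (volume.restrict (Icc (0 : ℝ) 1)) :=
          eLpNorm_le_eLpNorm_of_exponent_le (by norm_num) hm
      _ ≤ eLpNorm (fun s => b (x + s)) 2 volume :=
          eLpNorm_mono_measure _ Measure.restrict_le_self
      _ = eLpNorm b 2 volume :=
          eLpNorm_comp_measurePreserving (Lp.aestronglyMeasurable b)
            (measurePreserving_add_left volume x)
      _ = ‖b‖ₑ := by rw [Lp.enorm_def]
  calc ∫⁻ x in A, ∫⁻ s in Icc (0 : ℝ) 1, ‖b (x + s)‖ₑ ≤ ∫⁻ x in A, ‖b‖ₑ :=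
        lintegral_mono key
    _ = ‖b‖ₑ * volume A := by simp

theorem abs_integral_inner_indicator_transl_le (b : L2) {A : Set ℝ} (hA : MeasurableSet A)
    (hA' : volume A ≠ ⊤) {k : ℝ → ℝ} (hk : ∀ s ∈ Icc (0 : ℝ) 1, |k s| ≤ 1) :
    |∫ s in (0 : ℝ)..1, k s * inner ℝ (indicatorConstLp 2 hA hA' (1 : ℝ)) (transl s b)|
      ≤ ‖b‖ * volume.real A := by
  rw [intervalIntegral.integral_of_le zero_le_one, ← integral_Icc_eq_integral_Ioc]
  have h1 : ‖∫ s in Icc (0 : ℝ) 1, k s * inner ℝ (indicatorConstLp 2 hA hA' (1 : ℝ))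
      (transl s b)‖ₑ ≤ ‖b‖ₑ * volume A := by
    refine le_trans (enorm_integral_le_lintegral_enorm _) ?_
    refine le_trans ?_ (lintegral_enorm_transl_le b A)
    refine setLIntegral_mono' measurableSet_Icc fun s hs => ?_
    rw [enorm_mul, L2.inner_indicatorConstLp_one]
    have h2 : ‖k s‖ₑ ≤ 1 := by
      rw [← enorm_one (G := ℝ), enorm_le_iff_norm_le]
      simpa using hk s hs
    calc ‖k s‖ₑ * ‖∫ x in A, transl s b x‖ₑ ≤ 1 * ‖∫ x in A, transl s b x‖ₑ := by gcongr
      _ = ‖∫ x in A, transl s b x‖ₑ := one_mul _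
      _ ≤ ∫⁻ x in A, ‖transl s b x‖ₑ := enorm_integral_le_lintegral_enorm _
      _ = ∫⁻ x in A, ‖b (x + s)‖ₑ := by
        refine lintegral_congr_ae (ae_restrict_of_ae ?_)
        filter_upwards [coeFn_transl s b] with x hx
        rw [hx]
  have h3 := ENNReal.toReal_mono (ENNReal.mul_ne_top (by simp) hA') h1
  simpa [ENNReal.toReal_mul, Measure.real] using h3

/-- An averaged form of `a(x) = ∫₀¹ a(x+s) ds - ∫₀¹ (1-s) a'(x+s) ds`. Testing against the indicator
of `A` avoids pointwise values of `a`, and each integral contributes an `L²` norm times the measure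
of `A`. -/
theorem HasWeakDeriv.setIntegral_le {a g : L2} (H : HasWeakDeriv a g) {A : Set ℝ}
    (hA : MeasurableSet A) (hA' : volume A ≠ ⊤) :
    |∫ x in A, a x| ≤ (‖a‖ + ‖g‖) * volume.real A := by
  rw [← L2.inner_indicatorConstLp_one hA hA' a]
  set χ : L2 := indicatorConstLp 2 hA hA' (1 : ℝ)
  have hcont : ∀ b : L2, Continuous fun s => inner ℝ χ (DampedWave.transl s b) := fun b =>
    continuous_const.inner (continuous_transl continuous_id continuous_const)
  -- The weight `1 - s` equals one at `s = 0` and removes the boundary term at `s = 1`.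
  have hd : ∀ s ∈ uIcc (0 : ℝ) 1,
      HasDerivAt (fun s => (1 - s) * inner ℝ χ (DampedWave.transl s a))
        (-1 * inner ℝ χ (DampedWave.transl s a) +
          (1 - s) * inner ℝ χ (DampedWave.transl s g)) s := by
    intro s _
    have h1 := (innerSL ℝ χ).hasFDerivAt.comp_hasDerivAt s (H.hasDerivAt s)
    exact ((hasDerivAt_id s).const_sub 1).mul h1
  have h1 := intervalIntegral.integral_eq_sub_of_hasDerivAt hd
    (((continuous_const.mul (hcont a)).add
      ((continuous_const.sub continuous_id).mul (hcont g))).intervalIntegrable (μ := volume) _ _)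
  have hi : Continuous fun s => (1 - s) * inner ℝ χ (DampedWave.transl s g) :=
    (continuous_const.sub continuous_id).mul (hcont g)
  rw [intervalIntegral.integral_add
    (((hcont a).const_mul (-1)).intervalIntegrable _ _) (hi.intervalIntegrable _ _)] at h1
  simp only [sub_self, zero_mul, sub_zero, one_mul, transl_zero, zero_sub] at h1
  have e1 := abs_integral_inner_indicator_transl_le a hA hA' (k := fun _ => -1) (by simp)
  have e2 := abs_integral_inner_indicator_transl_le g hA hA' (k := fun s => 1 - s)
    (fun s hs => abs_le.2 ⟨by linarith [hs.2], by linarith [hs.1]⟩)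
  rw [← abs_neg, ← h1]
  refine (abs_add_le _ _).trans ?_
  rw [add_mul]
  exact add_le_add e1 e2

theorem ae_le_of_forall_setIntegral_le_mul (a : L2) (C : ℝ)
    (h : ∀ A : Set ℝ, MeasurableSet A → volume A ≠ ⊤ → ∫ x in A, a x ≤ C * volume.real A) :
    ∀ᵐ x, a x ≤ C := by
  have hloc : LocallyIntegrable a volume := (Lp.memLp a).locallyIntegrable (by norm_num)
  have h1 : ∀ n : ℕ, ∀ᵐ x ∂(volume.restrict (Icc (-(n : ℝ)) n)), a x ≤ C := by
    intro n
    refine ae_le_of_forall_setIntegral_le (hloc.integrableOn_isCompact isCompact_Icc)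
      (integrable_const C) fun s hs _ => ?_
    have hfin : volume (s ∩ Icc (-(n : ℝ)) n) ≠ ⊤ :=
      ((measure_mono inter_subset_right).trans_lt isCompact_Icc.measure_lt_top).ne
    rw [Measure.restrict_restrict hs]
    refine (h _ (hs.inter measurableSet_Icc) hfin).trans (le_of_eq ?_)
    simp [mul_comm]
  have h2 := ae_all_iff.2 fun n : ℕ => (ae_restrict_iff' measurableSet_Icc).1 (h1 n)
  filter_upwards [h2] with x hx
  obtain ⟨n, hn⟩ := exists_nat_ge |x|
  exact hx n (abs_le.1 hn)

/-- The Sobolev embedding `H¹(ℝ) ⊂ L^∞(ℝ)`. -/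
theorem HasWeakDeriv.ae_abs_le {a g : L2} (H : HasWeakDeriv a g) :
    ∀ᵐ x, |a x| ≤ ‖a‖ + ‖g‖ := by
  have h1 := ae_le_of_forall_setIntegral_le_mul a (‖a‖ + ‖g‖) fun A hA hA' =>
    (le_abs_self _).trans (H.setIntegral_le hA hA')
  have h2 := ae_le_of_forall_setIntegral_le_mul (-a) (‖a‖ + ‖g‖) fun A hA hA' => by
    refine le_trans ?_ ((neg_le_abs _).trans (H.setIntegral_le hA hA'))
    rw [← integral_neg]
    refine le_of_eq (integral_congr_ae (ae_restrict_of_ae ?_))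
    filter_upwards [Lp.coeFn_neg a] with x hx using hx
  filter_upwards [h1, h2, Lp.coeFn_neg a] with x h1 h2 h3
  rw [h3, Pi.neg_apply] at h2
  exact abs_le.2 ⟨by linarith, h1⟩

/-! ### Maps between Sobolev spaces -/

namespace Sobolev

variable {k : ℕ}

/-- The `i`-th weak derivative, as a continuous linear map. -/
def proj (k : ℕ) (i : Fin (k + 1)) : Sobolev k →L[ℝ] L2 :=
  (PiLp.proj 1 (fun _ : Fin (k + 1) => L2) i).comp (Sobolev k).subtypeL

theorem norm_coord_le (F : Sobolev k) (i : Fin (k + 1)) : ‖F.1 i‖ ≤ ‖F‖ := by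
  rw [norm_eq]
  exact Finset.single_le_sum (f := fun i => ‖F.1 i‖) (fun _ _ => norm_nonneg _)
    (Finset.mem_univ i)

theorem norm_one_eq (F : Sobolev 1) : ‖F‖ = ‖F.1 0‖ + ‖F.1 1‖ := by
  rw [norm_eq, Fin.sum_univ_two]

theorem norm_two_eq (F : Sobolev 2) : ‖F‖ = ‖F.1 0‖ + ‖F.1 1‖ + ‖F.1 2‖ := by
  rw [norm_eq, Fin.sum_univ_three]

theorem hasWeakDeriv (F : Sobolev 1) : HasWeakDeriv (F.1 0) (F.1 1) := F.2 0

theorem ae_abs_le (F : Sobolev 1) : ∀ᵐ x, |toL2 F x| ≤ ‖F‖ := by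
  rw [norm_one_eq]; exact (hasWeakDeriv F).ae_abs_le

theorem ext_toL2 {F G : Sobolev k} (h : toL2 F = toL2 G) : F = G := by
  apply Subtype.ext
  ext1 i
  induction i using Fin.induction with
  | zero => exact h
  | succ i ih => exact (F.2 i).unique (ih ▸ G.2 i)

/-- The translation `f ↦ f(· + h)` on `H^k(ℝ)`. -/
def transl (h : ℝ) : Sobolev k →ₗᵢ[ℝ] Sobolev k where
  toFun F := ⟨WithLp.toLp 1 fun i => DampedWave.transl h (F.1 i), fun i => (F.2 i).transl h⟩
  map_add' F G := by
    apply Subtype.ext; ext1 i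
    exact map_add (DampedWave.transl h) (F.1 i) (G.1 i)
  map_smul' c F := by
    apply Subtype.ext; ext1 i
    exact map_smul (DampedWave.transl h) c (F.1 i)
  norm_map' F := by
    rw [norm_eq, norm_eq]
    exact Finset.sum_congr rfl fun i _ => (DampedWave.transl h).norm_map _

@[simp]
theorem toL2_transl (h : ℝ) (F : Sobolev k) :
    toL2 (transl h F) = DampedWave.transl h (toL2 F) := rfl

@[simp]
theorem transl_zero (F : Sobolev k) : transl 0 F = F := ext_toL2 (by simp)

@[simp]
theorem transl_neg_transl (h : ℝ) (F : Sobolev k) : transl (-h) (transl h F) = F :=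
  ext_toL2 (by simp)

@[simp]
theorem transl_transl_neg (h : ℝ) (F : Sobolev k) : transl h (transl (-h) F) = F :=
  ext_toL2 (by simp)

theorem continuousWithinAt_of_coord {Z : Type*} [TopologicalSpace Z] {F : Z → Sobolev k}
    {S : Set Z} {z : Z} (h : ∀ i, ContinuousWithinAt (fun z => (F z).1 i) S z) :
    ContinuousWithinAt F S z := by
  rw [ContinuousWithinAt, tendsto_iff_norm_sub_tendsto_zero]
  simp only [norm_eq]
  rw [← Finset.sum_const_zero (s := (Finset.univ : Finset (Fin (k + 1))))]
  exact tendsto_finsetSum _ fun i _ => tendsto_iff_norm_sub_tendsto_zero.1 (h i)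

theorem continuous_of_coord {Z : Type*} [TopologicalSpace Z] {F : Z → Sobolev k}
    (h : ∀ i, Continuous fun z => (F z).1 i) : Continuous F := by
  rw [← continuousOn_univ]
  exact fun z _ => continuousWithinAt_of_coord fun i => (h i).continuousWithinAt

theorem continuous_transl {Z : Type*} [TopologicalSpace Z] {h : Z → ℝ} {F : Z → Sobolev k}
    (hh : Continuous h) (hF : Continuous F) : Continuous fun z => transl (h z) (F z) :=
  continuous_of_coord fun i =>
    DampedWave.continuous_transl hh ((proj k i).continuous.comp hF)

/-- The element of `H¹(ℝ)` with given weak derivative. -/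
def mkOne (a g : L2) (h : HasWeakDeriv a g) : Sobolev 1 :=
  ⟨WithLp.toLp 1 ![a, g], fun i => by rw [Fin.fin_one_eq_zero i]; exact h⟩

/-- The element of `H²(ℝ)` with given weak derivative in `H¹(ℝ)`. -/
def mkTwo (a : L2) (q : Sobolev 1) (h : HasWeakDeriv a (toL2 q)) : Sobolev 2 :=
  ⟨WithLp.toLp 1 ![a, q.1 0, q.1 1], fun i => by
    fin_cases i
    · exact h
    · exact q.2 0⟩

end Sobolev

/-! ### The power nonlinearity and its superposition operator on `H¹(ℝ)`. -/

theorem hasDerivAt_abs_rpow_mul_self (x : ℝ) {q : ℝ} (hq : 1 < q) :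
    HasDerivAt (fun y : ℝ => |y| ^ (q - 1) * y) (q * |x| ^ (q - 1)) x := by
  rcases lt_trichotomy x 0 with hx | hx | hx
  · have h1 : HasDerivAt (fun y : ℝ => -(-y) ^ q) (q * |x| ^ (q - 1)) x := by
      have := ((hasDerivAt_neg x).rpow_const (p := q) (Or.inr hq.le)).neg
      rw [abs_of_neg hx]
      convert! this using 1
      ring
    refine h1.congr_of_eventuallyEq ?_
    filter_upwards [Iio_mem_nhds hx] with y hy
    have hy' : 0 < -y := by simpa using hy
    rw [abs_of_neg hy]
    have := Real.rpow_add_one hy'.ne' (q - 1)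
    rw [sub_add_cancel] at this
    rw [this]; ring
  · subst hx
    rw [hasDerivAt_iff_tendsto_slope_zero]
    have h0 : Tendsto (fun t : ℝ => |t| ^ (q - 1)) (𝓝[≠] 0) (𝓝 (q * |(0:ℝ)| ^ (q - 1))) := by
      have hc : Continuous fun t : ℝ => |t| ^ (q - 1) :=
        continuous_abs.rpow_const fun _ => Or.inr (by linarith)
      have := hc.tendsto 0
      simp only [abs_zero, Real.zero_rpow (by linarith : q - 1 ≠ 0), mul_zero] at this ⊢
      exact this.mono_left nhdsWithin_le_nhds
    refine h0.congr' ?_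
    filter_upwards [self_mem_nhdsWithin] with t ht
    have : t ≠ 0 := ht
    simp only [zero_add, abs_zero, mul_zero, sub_zero, smul_eq_mul]
    field_simp
  · have h1 : HasDerivAt (fun y : ℝ => y ^ q) (q * |x| ^ (q - 1)) x := by
      rw [abs_of_pos hx]
      exact Real.hasDerivAt_rpow_const (Or.inr hq.le)
    refine h1.congr_of_eventuallyEq ?_
    filter_upwards [Ioi_mem_nhds hx] with y hy
    rw [abs_of_pos hy]
    have := Real.rpow_add_one (ne_of_gt hy) (q - 1)
    rw [sub_add_cancel] at this
    rw [this]

/-- `f` is twice differentiable, with the growth of the power `|y|^p`. -/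
structure PowerLike (f f' : ℝ → ℝ) (c p : ℝ) : Prop where
  two_lt : 2 < p
  pos : 0 < c
  hasDerivAt : ∀ x, HasDerivAt f (f' x) x
  zero : f 0 = 0
  deriv_zero : f' 0 = 0
  deriv_lipschitz : ∀ M x y, |x| ≤ M → |y| ≤ M → |f' y - f' x| ≤ c * M ^ (p - 2) * |y - x|

theorem powerLike_of_hasDerivAt {f f' f'' : ℝ → ℝ} {c p : ℝ} (hp : 2 < p) (hc : 0 < c)
    (h : ∀ x, HasDerivAt f (f' x) x) (h' : ∀ x, HasDerivAt f' (f'' x) x)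
    (h0 : f 0 = 0) (h0' : f' 0 = 0) (hb : ∀ x, |f'' x| ≤ c * |x| ^ (p - 2)) :
    PowerLike f f' c p where
  two_lt := hp
  pos := hc
  hasDerivAt := h
  zero := h0
  deriv_zero := h0'
  deriv_lipschitz M x y hx hy := by
    have := (convex_Icc (-M) M).norm_image_sub_le_of_norm_hasDerivWithin_le
      (f := f') (f' := f'') (C := c * M ^ (p - 2)) (x := x) (y := y)
      (fun z _ => (h' z).hasDerivWithinAt) (fun z hz => ?_) (abs_le.1 hx) (abs_le.1 hy)
    · simpa using this
    · refine (hb z).trans ?_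
      gcongr
      exact abs_le.2 hz

theorem exists_powerLike {f : ℝ → ℝ} {p : ℝ} (hp : 2 < p)
    (hf : f = (fun y => |y| ^ p) ∨ f = fun y => |y| ^ (p - 1) * y) :
    ∃ f' c, PowerLike f f' c p := by
  have hpos : 0 < p * (p - 1) := by nlinarith
  have hb : ∀ x : ℝ, |(|x| ^ (p - 2))| = |x| ^ (p - 2) := fun x => abs_of_nonneg (by positivity)
  rcases hf with rfl | rfl
  · refine ⟨fun y => p * (|y| ^ (p - 1 - 1) * y), p * (p - 1),
      powerLike_of_hasDerivAt (f'' := fun y => p * ((p - 1) * |y| ^ (p - 1 - 1))) hp hpos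
      (fun x => ?_) (fun x => (hasDerivAt_abs_rpow_mul_self x (by linarith)).const_mul p) ?_ ?_
      fun x => ?_⟩
    · have := hasDerivAt_abs_rpow x (by linarith : 1 < p)
      rw [sub_sub, one_add_one_eq_two, ← mul_assoc]
      exact this
    · simp [Real.zero_rpow (by linarith : p ≠ 0)]
    · simp
    · rw [sub_sub, one_add_one_eq_two, abs_mul, abs_mul, hb, ← mul_assoc,
        abs_of_pos (by linarith : 0 < p), abs_of_pos (by linarith : 0 < p - 1)]
  · refine ⟨fun y => p * |y| ^ (p - 1), p * (p - 1),
      powerLike_of_hasDerivAt (f'' := fun y => p * ((p - 1) * |y| ^ (p - 1 - 2) * y)) hp hpos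
      (fun x => hasDerivAt_abs_rpow_mul_self x (by linarith))
      (fun x => (hasDerivAt_abs_rpow x (by linarith : 1 < p - 1)).const_mul p) ?_ ?_
      fun x => ?_⟩
    · simp
    · simp [Real.zero_rpow (by linarith : p - 1 ≠ 0)]
    -- The exponent `p - 3` may be negative, so `|x|^(p-2) = |x|^(p-3) |x|` is used only away from
    -- zero.
    · rcases eq_or_ne x 0 with rfl | hx
      · simp [Real.zero_rpow (by linarith : p - 2 ≠ 0)]
      · have hx' : 0 < |x| := abs_pos.2 hx
        have e : |x| ^ (p - 2) = |x| ^ (p - 1 - 2) * |x| := by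
          rw [← Real.rpow_add_one hx'.ne']; congr 1; ring
        rw [e, abs_mul, abs_mul, abs_mul, abs_of_pos (by linarith : 0 < p),
          abs_of_pos (by linarith : 0 < p - 1), abs_of_nonneg (by positivity : 0 ≤ |x| ^ (p - 1 - 2))]
        exact le_of_eq (by ring)

namespace PowerLike

variable {f f' : ℝ → ℝ} {c p : ℝ}

theorem continuous (h : PowerLike f f' c p) : Continuous f :=
  continuous_iff_continuousAt.2 fun x => (h.hasDerivAt x).continuousAt

theorem rpow_succ (h : PowerLike f f' c p) {M : ℝ} (hM : 0 ≤ M) :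
    M ^ (p - 1) = M ^ (p - 2) * M := by
  have := h.two_lt
  rcases hM.eq_or_lt with rfl | hM
  · rw [Real.zero_rpow (by linarith), mul_zero]
  · rw [← Real.rpow_add_one hM.ne']; congr 1; ring

theorem continuous_deriv (h : PowerLike f f' c p) : Continuous f' := by
  refine continuous_iff_continuousAt.2 fun x => ?_
  rw [ContinuousAt, tendsto_iff_norm_sub_tendsto_zero]
  have h1 : Tendsto (fun y => c * (|x| + 1) ^ (p - 2) * |y - x|) (𝓝 x) (𝓝 0) := by
    have : Continuous fun y => c * (|x| + 1) ^ (p - 2) * |y - x| := by fun_prop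
    simpa using this.tendsto x
  refine tendsto_of_tendsto_of_tendsto_of_le_of_le' tendsto_const_nhds h1
    (Eventually.of_forall fun _ => norm_nonneg _) ?_
  filter_upwards [Metric.ball_mem_nhds x one_pos] with y hy
  refine h.deriv_lipschitz _ _ _ (by linarith [abs_nonneg x]) ?_
  have h2 : |y - x| < 1 := hy
  have h3 := abs_add_le x (y - x)
  rw [add_sub_cancel] at h3
  linarith

theorem abs_deriv_le (h : PowerLike f f' c p) {M x : ℝ} (hx : |x| ≤ M) :
    |f' x| ≤ c * M ^ (p - 1) := by
  have hM : 0 ≤ M := (abs_nonneg x).trans hx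
  have h1 := h.deriv_lipschitz M 0 x (by simpa using hM) hx
  rw [h.deriv_zero, sub_zero, sub_zero] at h1
  rw [h.rpow_succ hM, ← mul_assoc]
  exact h1.trans (mul_le_mul_of_nonneg_left hx (mul_nonneg h.pos.le (by positivity)))

theorem abs_sub_le (h : PowerLike f f' c p) {M x y : ℝ} (hx : |x| ≤ M) (hy : |y| ≤ M) :
    |f y - f x| ≤ c * M ^ (p - 1) * |y - x| := by
  have := (convex_Icc (-M) M).norm_image_sub_le_of_norm_hasDerivWithin_le
    (f := f) (f' := f') (C := c * M ^ (p - 1)) (x := x) (y := y)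
    (fun z _ => (h.hasDerivAt z).hasDerivWithinAt)
    (fun z hz => h.abs_deriv_le (abs_le.2 hz)) (abs_le.1 hx) (abs_le.1 hy)
  simpa using this

theorem abs_taylor_le (h : PowerLike f f' c p) {M x y : ℝ} (hx : |x| ≤ M) (hy : |y| ≤ M) :
    |f y - f x - f' x * (y - x)| ≤ c * M ^ (p - 2) * |y - x| * |y - x| := by
  have hM : 0 ≤ M := (abs_nonneg x).trans hx
  have := (convex_uIcc x y).norm_image_sub_le_of_norm_hasDerivWithin_le
    (f := fun z => f z - f' x * z) (f' := fun z => f' z - f' x)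
    (C := c * M ^ (p - 2) * |y - x|) (x := x) (y := y)
    (fun z _ => ((h.hasDerivAt z).sub (by
      simpa using (hasDerivAt_id z).const_mul (f' x))).hasDerivWithinAt)
    (fun z hz => ?_) left_mem_uIcc right_mem_uIcc
  · simp only [Real.norm_eq_abs] at this
    convert this using 2
    ring
  · have hzM : |z| ≤ M := by
      have : uIcc x y ⊆ Icc (-M) M := ordConnected_Icc.uIcc_subset (abs_le.1 hx) (abs_le.1 hy)
      exact abs_le.2 (this hz)
    refine (h.deriv_lipschitz M x z hx hzM).trans ?_
    exact mul_le_mul_of_nonneg_left (abs_sub_left_of_mem_uIcc hz)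
      (mul_nonneg h.pos.le (by positivity))

theorem abs_le (h : PowerLike f f' c p) {M x : ℝ} (hx : |x| ≤ M) :
    |f x| ≤ c * M ^ (p - 1) * |x| := by
  have hM : 0 ≤ M := (abs_nonneg x).trans hx
  have := h.abs_sub_le (M := M) (x := 0) (y := x) (by simpa using hM) hx
  simpa [h.zero] using this

theorem memLp_comp (h : PowerLike f f' c p) (a : Sobolev 1) :
    MemLp (fun x => f (toL2 a x)) 2 volume := by
  refine MemLp.of_le_mul (c := c * ‖a‖ ^ (p - 1)) (Lp.memLp (toL2 a))
    (h.continuous.comp_aestronglyMeasurable (Lp.aestronglyMeasurable _)) ?_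
  filter_upwards [Sobolev.ae_abs_le a] with x hx
  exact h.abs_le hx

theorem memLp_deriv_comp_mul (h : PowerLike f f' c p) (a : Sobolev 1) (b : L2) :
    MemLp (fun x => f' (toL2 a x) * b x) 2 volume := by
  refine MemLp.of_le_mul (c := c * ‖a‖ ^ (p - 1)) (Lp.memLp b)
    ((h.continuous_deriv.comp_aestronglyMeasurable (Lp.aestronglyMeasurable _)).mul
      (Lp.aestronglyMeasurable _)) ?_
  filter_upwards [Sobolev.ae_abs_le a] with x hx
  rw [norm_mul]
  exact mul_le_mul_of_nonneg_right (h.abs_deriv_le hx) (norm_nonneg _)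

/-- The chain rule, by differentiating along translations: with `d = transl s a - a`, the error `f(a
+ d) - f(a) - s f'(a) a'` is a quadratic Taylor remainder plus `f'(a)(d - s a')`. In the remainder
one factor `d` is bounded uniformly by the `H¹` norm, which tends to zero, and the other is `O(s)`
in `L²`; the second term is `o(s)` because `a` is differentiable along translations. -/
theorem hasWeakDeriv_comp (h : PowerLike f f' c p) (a : Sobolev 1) :
    HasWeakDeriv ((h.memLp_comp a).toLp _) ((h.memLp_deriv_comp_mul a (a.1 1)).toLp _) := by
  apply hasWeakDeriv_of_hasDerivAt
  rw [hasDerivAt_iff_isLittleO_nhds_zero]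
  set F := (h.memLp_comp a).toLp _
  set G := (h.memLp_deriv_comp_mul a (a.1 1)).toLp _
  set K := c * ‖a‖ ^ (p - 2)
  set K' := c * ‖a‖ ^ (p - 1)
  have hK : 0 ≤ K := mul_nonneg h.pos.le (by positivity)
  have hK' : 0 ≤ K' := mul_nonneg h.pos.le (by positivity)
  have main : ∀ s : ℝ, ‖transl s F - F - s • G‖ ≤
      K * ‖Sobolev.transl s a - a‖ * ‖transl s (toL2 a) - toL2 a‖ +
        K' * ‖transl s (toL2 a) - toL2 a - s • a.1 1‖ := by
    intro s
    set d : L2 := transl s (toL2 a) - toL2 a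
    set e : L2 := d - s • a.1 1
    set P := (h.memLp_deriv_comp_mul a e).toLp _
    have h1 : ‖P‖ ≤ K' * ‖e‖ := by
      refine Lp.norm_le_mul_norm_of_ae_le_mul ?_
      filter_upwards [(h.memLp_deriv_comp_mul a e).coeFn_toLp, Sobolev.ae_abs_le a] with x hx hx'
      rw [hx, norm_mul]
      exact mul_le_mul_of_nonneg_right (h.abs_deriv_le hx') (norm_nonneg _)
    have h2 : ‖transl s F - F - s • G - P‖ ≤ K * ‖Sobolev.transl s a - a‖ * ‖d‖ := by
      refine Lp.norm_le_mul_norm_of_ae_le_mul ?_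
      have hF := (h.memLp_comp a).coeFn_toLp
      have hFs := (measurePreserving_add_right (volume : Measure ℝ) s).quasiMeasurePreserving.ae hF
      have hbs := (measurePreserving_add_right (volume : Measure ℝ) s).quasiMeasurePreserving.ae
        (Sobolev.ae_abs_le a)
      filter_upwards [Lp.coeFn_sub (transl s F - F - s • G) P,
        Lp.coeFn_sub (transl s F - F) (s • G), Lp.coeFn_sub (transl s F) F,
        Lp.coeFn_smul s G, coeFn_transl s F, hF, hFs, hbs,
        (h.memLp_deriv_comp_mul a (a.1 1)).coeFn_toLp, (h.memLp_deriv_comp_mul a e).coeFn_toLp,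
        Lp.coeFn_sub (transl s (toL2 a)) (toL2 a), coeFn_transl s (toL2 a),
        Lp.coeFn_sub d (s • a.1 1), Lp.coeFn_smul s (a.1 1), Sobolev.ae_abs_le a,
        Sobolev.ae_abs_le (Sobolev.transl s a - a)]
        with x e1 e2 e3 e4 e5 e6 e7 e8 e9 e10 e11 e12 e13 e14 e15 e16
      have hd : toL2 (Sobolev.transl s a - a) x = d x := rfl
      have e3' : d x = toL2 a (x + s) - toL2 a x := by rw [e11, Pi.sub_apply, e12]
      have e4' : e x = d x - s * a.1 1 x := by rw [e13, Pi.sub_apply, e14]; rfl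
      rw [e1, Pi.sub_apply, e2, Pi.sub_apply, e3, Pi.sub_apply, e4, Pi.smul_apply, e5, e7, e6,
        e9, e10, e4', smul_eq_mul]
      rw [hd] at e16
      have t := h.abs_taylor_le e15 e8
      rw [← e3'] at t
      rw [Real.norm_eq_abs, Real.norm_eq_abs]
      calc _ = |f (toL2 a (x + s)) - f (toL2 a x) - f' (toL2 a x) * d x| := by
            congr 1; ring
        _ ≤ K * |d x| * |d x| := t
        _ ≤ _ := by gcongr
    calc ‖transl s F - F - s • G‖ = ‖(transl s F - F - s • G - P) + P‖ := by rw [sub_add_cancel]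
      _ ≤ _ := (norm_add_le _ _).trans (add_le_add h2 h1)
  have hd := (hasDerivAt_iff_isLittleO_nhds_zero.1 ((Sobolev.hasWeakDeriv a).hasDerivAt 0))
  have o2 : (fun s : ℝ => K' * ‖transl s (toL2 a) - toL2 a - s • a.1 1‖) =o[𝓝 0] fun s => s := by
    refine Asymptotics.IsLittleO.const_mul_left ?_ _
    have := hd.norm_left
    simp only [zero_add, transl_zero] at this
    exact this
  have t1 : Tendsto (fun s => K * ‖Sobolev.transl s a - a‖) (𝓝 0) (𝓝 0) := by
    have : Continuous fun s => K * ‖Sobolev.transl s a - a‖ :=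
      continuous_const.mul ((Sobolev.continuous_transl continuous_id continuous_const).sub
        continuous_const).norm
    simpa using this.tendsto 0
  have o1 : (fun s : ℝ => K * ‖Sobolev.transl s a - a‖ * ‖transl s (toL2 a) - toL2 a‖)
      =o[𝓝 0] fun s => s := by
    have h1 : (fun s => K * ‖Sobolev.transl s a - a‖) =o[𝓝 0] fun _ => (1 : ℝ) :=
      (Asymptotics.isLittleO_one_iff ℝ).2 t1
    have h2 : (fun s => ‖transl s (toL2 a) - toL2 a‖) =O[𝓝 0] fun s : ℝ => s := by
      refine Asymptotics.IsBigO.of_bound ‖a.1 1‖ (Eventually.of_forall fun s => ?_)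
      rw [norm_norm, mul_comm]
      exact (Sobolev.hasWeakDeriv a).norm_transl_sub_le s
    simpa using h1.mul_isBigO h2
  refine Asymptotics.IsBigO.trans_isLittleO ?_ (o1.add o2)
  refine Asymptotics.IsBigO.of_bound 1 (Eventually.of_forall fun s => ?_)
  rw [zero_add, transl_zero, one_mul]
  exact (main s).trans (le_abs_self _)

/-- The superposition operator `a ↦ f(a)` on `H¹(ℝ)`. -/
def nemytskii (h : PowerLike f f' c p) (a : Sobolev 1) : Sobolev 1 :=
  Sobolev.mkOne _ _ (h.hasWeakDeriv_comp a)

theorem coeFn_nemytskii (h : PowerLike f f' c p) (a : Sobolev 1) :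
    ∀ᵐ x, toL2 (h.nemytskii a) x = f (toL2 a x) :=
  (h.memLp_comp a).coeFn_toLp

theorem nemytskii_zero (h : PowerLike f f' c p) : h.nemytskii 0 = 0 := by
  apply Sobolev.ext_toL2
  apply Lp.ext
  filter_upwards [h.coeFn_nemytskii 0, Lp.coeFn_zero ℝ 2 (volume : Measure ℝ)] with x hx hx'
  have e : toL2 (0 : Sobolev 1) = 0 := rfl
  rw [hx, e, hx']
  exact h.zero

/-- For the derivative, `f'(a)a' - f'(b)b' = f'(a)(a' - b') + (f'(a) - f'(b))b'`. In the second term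
`f'` has Lipschitz constant `c M^(p-2)`, the difference `a - b` is taken in `L^∞`, and `‖b'‖ ≤ M`
restores the power `p - 1`. The constant `3` is not sharp. -/
theorem norm_nemytskii_sub_le (h : PowerLike f f' c p) (a b : Sobolev 1) {M : ℝ} (ha : ‖a‖ ≤ M)
    (hb : ‖b‖ ≤ M) :
    ‖h.nemytskii a - h.nemytskii b‖ ≤ 3 * c * M ^ (p - 1) * ‖a - b‖ := by
  have hM : 0 ≤ M := (norm_nonneg a).trans ha
  set L := c * M ^ (p - 1)
  have hL : 0 ≤ L := mul_nonneg h.pos.le (by positivity)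
  have h0 : ‖(h.nemytskii a - h.nemytskii b).1 0‖ ≤ L * ‖(a - b).1 0‖ := by
    refine Lp.norm_le_mul_norm_of_ae_le_mul ?_
    filter_upwards [Lp.coeFn_sub ((h.nemytskii a).1 0) ((h.nemytskii b).1 0),
      h.coeFn_nemytskii a, h.coeFn_nemytskii b, Lp.coeFn_sub (a.1 0) (b.1 0),
      Sobolev.ae_abs_le a, Sobolev.ae_abs_le b] with x e1 e2 e3 e4 e5 e6
    change ‖((h.nemytskii a).1 0 - (h.nemytskii b).1 0 : L2) x‖ ≤ L * ‖(a.1 0 - b.1 0 : L2) x‖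
    rw [e1, e4]
    change ‖toL2 (h.nemytskii a) x - toL2 (h.nemytskii b) x‖ ≤ _
    rw [e2, e3]
    exact h.abs_sub_le (e6.trans hb) (e5.trans ha)
  have h1 : ‖(h.nemytskii a - h.nemytskii b).1 1‖ ≤
      L * ‖(a - b).1 1‖ + L * ‖a - b‖ := by
    have d1 := h.memLp_deriv_comp_mul a ((a - b).1 1)
    set P := d1.toLp _
    have hP : ‖P‖ ≤ L * ‖(a - b).1 1‖ := by
      refine Lp.norm_le_mul_norm_of_ae_le_mul ?_
      filter_upwards [d1.coeFn_toLp, Sobolev.ae_abs_le a] with x hx hx'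
      rw [hx, norm_mul]
      exact mul_le_mul_of_nonneg_right (h.abs_deriv_le (hx'.trans ha)) (norm_nonneg _)
    have hQ : ‖(h.nemytskii a - h.nemytskii b).1 1 - P‖ ≤
        (c * M ^ (p - 2) * ‖a - b‖) * ‖b.1 1‖ := by
      refine Lp.norm_le_mul_norm_of_ae_le_mul ?_
      filter_upwards [Lp.coeFn_sub ((h.nemytskii a).1 1 - (h.nemytskii b).1 1) P,
        Lp.coeFn_sub ((h.nemytskii a).1 1) ((h.nemytskii b).1 1),
        (h.memLp_deriv_comp_mul a (a.1 1)).coeFn_toLp,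
        (h.memLp_deriv_comp_mul b (b.1 1)).coeFn_toLp, d1.coeFn_toLp,
        Lp.coeFn_sub (a.1 1) (b.1 1), Lp.coeFn_sub (a.1 0) (b.1 0),
        Sobolev.ae_abs_le a, Sobolev.ae_abs_le b, Sobolev.ae_abs_le (a - b)]
        with x e1 e2 e3 e4 e5 e6 e7 e8 e9 e10
      have e3' : (h.nemytskii a).1 1 x = f' (toL2 a x) * a.1 1 x := e3
      have e4' : (h.nemytskii b).1 1 x = f' (toL2 b x) * b.1 1 x := e4
      have e6' : (a - b).1 1 x = a.1 1 x - b.1 1 x := e6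
      have e7' : toL2 (a - b) x = toL2 a x - toL2 b x := e7
      change ‖((h.nemytskii a).1 1 - (h.nemytskii b).1 1 - P : L2) x‖ ≤ _
      rw [e1, Pi.sub_apply, e2, Pi.sub_apply, e3', e4', e5, e6']
      have t := h.deriv_lipschitz M _ _ (e9.trans hb) (e8.trans ha)
      rw [← e7'] at t
      have e : f' (toL2 a x) * a.1 1 x - f' (toL2 b x) * b.1 1 x -
          f' (toL2 a x) * (a.1 1 x - b.1 1 x) = (f' (toL2 a x) - f' (toL2 b x)) * b.1 1 x := by
        ring
      rw [e, norm_mul]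
      refine mul_le_mul_of_nonneg_right (t.trans ?_) (norm_nonneg _)
      exact mul_le_mul_of_nonneg_left e10 (mul_nonneg h.pos.le (by positivity))
    have hb1 : ‖b.1 1‖ ≤ M := (Sobolev.norm_coord_le b 1).trans hb
    have e : (c * M ^ (p - 2) * ‖a - b‖) * ‖b.1 1‖ ≤ L * ‖a - b‖ := by
      have : L = c * M ^ (p - 2) * M := by
        simp only [L]; rw [h.rpow_succ hM]; ring
      rw [this]
      have : 0 ≤ c * M ^ (p - 2) * ‖a - b‖ :=
        mul_nonneg (mul_nonneg h.pos.le (by positivity)) (norm_nonneg _)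
      calc _ ≤ c * M ^ (p - 2) * ‖a - b‖ * M := mul_le_mul_of_nonneg_left hb1 this
        _ = _ := by ring
    calc ‖(h.nemytskii a - h.nemytskii b).1 1‖
        = ‖P + ((h.nemytskii a - h.nemytskii b).1 1 - P)‖ := by rw [add_sub_cancel]
      _ ≤ _ := (norm_add_le _ _).trans (add_le_add hP (hQ.trans e))
  rw [Sobolev.norm_one_eq]
  have hn := Sobolev.norm_one_eq (a - b)
  have h3 : 0 ≤ L * ‖a - b‖ := mul_nonneg hL (norm_nonneg _)
  have h4 : 3 * c * M ^ (p - 1) * ‖a - b‖ = 3 * (L * ‖a - b‖) := by simp only [L]; ring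
  have h5 : L * ‖(a - b).1 0‖ + L * ‖(a - b).1 1‖ = L * ‖a - b‖ := by rw [hn]; ring
  rw [h4]
  linarith

theorem continuous_nemytskii (h : PowerLike f f' c p) : Continuous h.nemytskii := by
  refine continuous_iff_continuousAt.2 fun a => ?_
  rw [ContinuousAt, tendsto_iff_norm_sub_tendsto_zero]
  have h1 : Tendsto (fun b => 3 * c * (‖a‖ + 1) ^ (p - 1) * ‖b - a‖) (𝓝 a) (𝓝 0) := by
    have : Continuous fun b => 3 * c * (‖a‖ + 1) ^ (p - 1) * ‖b - a‖ := by fun_prop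
    simpa using this.tendsto a
  refine tendsto_of_tendsto_of_tendsto_of_le_of_le' tendsto_const_nhds h1
    (Eventually.of_forall fun _ => norm_nonneg _) ?_
  filter_upwards [Metric.ball_mem_nhds a one_pos] with b hb
  refine h.norm_nemytskii_sub_le _ _ ?_ (by linarith [norm_nonneg a])
  have h2 : ‖b - a‖ < 1 := by simpa [dist_eq_norm] using hb
  have h3 := norm_add_le a (b - a)
  rw [add_sub_cancel] at h3
  linarith

end PowerLike

/-! ### Strongly continuous families, weighted contractions and linear evolution equations. -/

section Families

variable {X Y : Type*} [NormedAddCommGroup X] [NormedSpace ℝ X] [NormedAddCommGroup Y]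
  [NormedSpace ℝ Y]

theorem continuous_family_apply {Z : Type*} [TopologicalSpace Z] {U : Z → X →L[ℝ] Y}
    (hU : ∀ x, Continuous fun z => U z x) {B : Z → ℝ} (hB : Continuous B)
    (hUB : ∀ z, ‖U z‖ ≤ B z) {y : Z → X} (hy : Continuous y) :
    Continuous fun z => U z (y z) := by
  refine continuous_iff_continuousAt.2 fun z₀ => ?_
  rw [ContinuousAt, tendsto_iff_norm_sub_tendsto_zero]
  have h1 : Tendsto (fun z => B z * ‖y z - y z₀‖ + ‖U z (y z₀) - U z₀ (y z₀)‖) (𝓝 z₀) (𝓝 0) := by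
    have : Continuous fun z => B z * ‖y z - y z₀‖ + ‖U z (y z₀) - U z₀ (y z₀)‖ :=
      (hB.mul (hy.sub continuous_const).norm).add ((hU _).sub continuous_const).norm
    simpa using this.tendsto z₀
  refine squeeze_zero (fun _ => norm_nonneg _) (fun z => ?_) h1
  have e : U z (y z) - U z₀ (y z₀) = U z (y z - y z₀) + (U z (y z₀) - U z₀ (y z₀)) := by
    rw [map_sub]; abel
  rw [e]
  refine (norm_add_le _ _).trans (add_le_add_left ?_ _)
  exact ((U z).le_opNorm _).trans (mul_le_mul_of_nonneg_right (hUB z) (norm_nonneg _))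

/-- A product rule for families that are only strongly continuous, as translations are: a locally
bounded operator norm replaces continuity in operator norm. -/
theorem hasDerivWithinAt_family_apply {U : ℝ → X →L[ℝ] Y}
    (hU : ∀ x, Continuous fun t => U t x) {B : ℝ → ℝ} (hB : Continuous B)
    (hUB : ∀ t, ‖U t‖ ≤ B t) {y : ℝ → X} {y' : X} {d : Y} {S : Set ℝ} {t₀ : ℝ}
    (hy : HasDerivWithinAt y y' S t₀)
    (hd : HasDerivWithinAt (fun t => U t (y t₀)) d S t₀) :
    HasDerivWithinAt (fun t => U t (y t)) (d + U t₀ y') S t₀ := by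
  rw [hasDerivWithinAt_iff_isLittleO] at hy hd ⊢
  have o1 : (fun t => U t (y t - y t₀ - (t - t₀) • y')) =o[𝓝[S] t₀] fun t => t - t₀ := by
    have b1 : (fun t => U t (y t - y t₀ - (t - t₀) • y')) =O[𝓝[S] t₀]
        fun t => y t - y t₀ - (t - t₀) • y' := by
      refine Asymptotics.IsBigO.of_bound (B t₀ + 1) ?_
      have : ∀ᶠ t in 𝓝[S] t₀, B t < B t₀ + 1 :=
        (hB.continuousAt.eventually_lt continuousAt_const (by linarith)).filter_mono
          nhdsWithin_le_nhds
      filter_upwards [this] with t ht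
      exact ((U t).le_opNorm _).trans (mul_le_mul_of_nonneg_right ((hUB t).trans ht.le)
        (norm_nonneg _))
    exact b1.trans_isLittleO hy
  have o2 : (fun t => (t - t₀) • (U t y' - U t₀ y')) =o[𝓝[S] t₀] fun t => t - t₀ := by
    have h1 : (fun t => U t y' - U t₀ y') =o[𝓝[S] t₀] fun _ => (1 : ℝ) := by
      rw [Asymptotics.isLittleO_one_iff]
      have : Continuous fun t => U t y' - U t₀ y' := (hU y').sub continuous_const
      simpa using (this.tendsto t₀).mono_left nhdsWithin_le_nhds
    simpa using (Asymptotics.isBigO_refl (fun t : ℝ => t - t₀) _).smul_isLittleO h1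
  refine ((hd.add o1).add o2).congr_left fun t => ?_
  simp only [map_sub, map_smul, smul_sub, smul_add]
  abel

end Families

section WeightedFixedPoint

variable {X Z : Type*} [NormedAddCommGroup X] [NormedSpace ℝ X] [CompleteSpace X]
  [TopologicalSpace Z]

/-- The contraction principle in a ball of a weighted space of continuous functions. -/
theorem exists_fixedPoint_of_weight {wt : Z → ℝ} (hwt : Continuous wt) (hpos : ∀ z, 0 < wt z)
    {M q : ℝ} (hM : 0 ≤ M) (hq : 0 ≤ q) (hq' : q < 1) (Ψ : (Z → X) → Z → X)
    (hcont : ∀ x, Continuous x → (∀ z, ‖x z‖ ≤ M * wt z) → Continuous (Ψ x))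
    (hball : ∀ x, Continuous x → (∀ z, ‖x z‖ ≤ M * wt z) → ∀ z, ‖Ψ x z‖ ≤ M * wt z)
    (hcontr : ∀ x y, Continuous x → Continuous y → (∀ z, ‖x z‖ ≤ M * wt z) →
      (∀ z, ‖y z‖ ≤ M * wt z) → ∀ D, 0 ≤ D → (∀ z, ‖x z - y z‖ ≤ D * wt z) →
      ∀ z, ‖Ψ x z - Ψ y z‖ ≤ q * D * wt z) :
    ∃ x, Continuous x ∧ (∀ z, ‖x z‖ ≤ M * wt z) ∧ Ψ x = x := by
  let 𝒮 : Set (BoundedContinuousFunction Z X) := {y | ∀ z, ‖y z‖ ≤ M}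
  have hclosed : IsClosed 𝒮 := by
    simp only [𝒮, ofPred_forall]
    exact isClosed_iInter fun z => isClosed_le
      (ContinuousEvalConst.continuous_eval_const z).norm continuous_const
  have : CompleteSpace 𝒮 := hclosed.completeSpace_coe
  let lift : 𝒮 → Z → X := fun y z => wt z • y.1 z
  have lcont : ∀ y, Continuous (lift y) := fun y => hwt.smul y.1.continuous
  have lbd : ∀ y z, ‖lift y z‖ ≤ M * wt z := fun y z => by
    rw [norm_smul, Real.norm_of_nonneg (hpos z).le, mul_comm]
    exact mul_le_mul_of_nonneg_right (y.2 z) (hpos z).le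
  have wbd : ∀ (v : X) (z : Z) (C : ℝ), ‖v‖ ≤ C * wt z → ‖(wt z)⁻¹ • v‖ ≤ C := fun v z C h => by
    rw [norm_smul, norm_inv, Real.norm_of_nonneg (hpos z).le, inv_mul_le_iff₀ (hpos z), mul_comm]
    exact h
  -- Conjugation by the weight turns the weighted ball into a closed ball of bounded continuous
  -- functions.
  let T : 𝒮 → 𝒮 := fun y =>
    ⟨BoundedContinuousFunction.ofNormedAddCommGroup (fun z => (wt z)⁻¹ • Ψ (lift y) z)
      ((hwt.inv₀ fun z => (hpos z).ne').smul (hcont _ (lcont y) (lbd y))) M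
      fun z => wbd _ _ _ (hball _ (lcont y) (lbd y) z),
      fun z => wbd _ _ _ (hball _ (lcont y) (lbd y) z)⟩
  have hT : ContractingWith ⟨q, hq⟩ T := by
    refine ⟨by exact_mod_cast hq', LipschitzWith.of_dist_le_mul fun x y => ?_⟩
    change dist (T x).1 (T y).1 ≤ q * dist x.1 y.1
    rw [BoundedContinuousFunction.dist_le (mul_nonneg hq dist_nonneg)]
    intro z
    change dist ((wt z)⁻¹ • Ψ (lift x) z) ((wt z)⁻¹ • Ψ (lift y) z) ≤ _
    rw [dist_eq_norm, ← smul_sub]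
    refine wbd _ _ _ (hcontr _ _ (lcont x) (lcont y) (lbd x) (lbd y) _ dist_nonneg (fun z => ?_) z)
    rw [← smul_sub, norm_smul, Real.norm_of_nonneg (hpos z).le, mul_comm, ← dist_eq_norm]
    exact mul_le_mul_of_nonneg_right (BoundedContinuousFunction.dist_coe_le_dist z) (hpos z).le
  have : Nonempty 𝒮 := ⟨⟨0, fun z => by simpa using hM⟩⟩
  let y := ContractingWith.fixedPoint T hT
  have hy : T y = y := ContractingWith.fixedPoint_isFixedPt (f := T) hT
  refine ⟨lift y, lcont y, lbd y, ?_⟩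
  ext z
  have h1 : (wt z)⁻¹ • Ψ (lift y) z = y.1 z := by
    conv_rhs => rw [← hy]
    rfl
  change _ = wt z • y.1 z
  rw [← h1, smul_inv_smul₀ (hpos z).ne']

end WeightedFixedPoint

theorem abs_integral_exp_abs_le {L : ℝ} (hL : 0 < L) (s t : ℝ) :
    |∫ τ in s..t, Real.exp (L * |τ - s|)| ≤ Real.exp (L * |t - s|) / L := by
  have h1 : ∀ r, 0 ≤ r → ∫ τ in (0 : ℝ)..r, Real.exp (L * |τ|) = (Real.exp (L * r) - 1) / L := by
    intro r hr
    have : ∫ τ in (0 : ℝ)..r, Real.exp (L * |τ|) = ∫ τ in (0 : ℝ)..r, Real.exp (L * τ) := by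
      refine intervalIntegral.integral_congr fun τ hτ => ?_
      rw [uIcc_of_le hr] at hτ
      simp only [abs_of_nonneg hτ.1]
    rw [this, intervalIntegral.integral_comp_mul_left (fun x => Real.exp x) hL.ne', integral_exp]
    simp [div_eq_inv_mul]
  have h2 : ∀ r, |∫ τ in (0 : ℝ)..r, Real.exp (L * |τ|)| = (Real.exp (L * |r|) - 1) / L := by
    intro r
    have h3 : ∀ r, 0 ≤ r → |∫ τ in (0 : ℝ)..r, Real.exp (L * |τ|)| =
        (Real.exp (L * |r|) - 1) / L := fun r hr => by
      rw [h1 r hr, abs_of_nonneg hr, abs_of_nonneg]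
      exact div_nonneg (by linarith [Real.one_le_exp (mul_nonneg hL.le hr)]) hL.le
    rcases le_total 0 r with hr | hr
    · exact h3 r hr
    · rw [← abs_neg r, ← h3 (-r) (by linarith)]
      have := intervalIntegral.integral_comp_neg (a := 0) (b := r) fun τ => Real.exp (L * |τ|)
      simp only [abs_neg, neg_zero] at this
      rw [this, intervalIntegral.integral_symm, abs_neg]
  have h3 := intervalIntegral.integral_comp_sub_right (a := s) (b := t)
    (fun τ => Real.exp (L * |τ|)) s
  rw [h3, sub_self, h2]
  exact div_le_div_of_nonneg_right (by linarith) hL.le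

/-- A bounded strongly continuous family of generators of a linear ODE. -/
structure IsGenerator {X : Type*} [NormedAddCommGroup X] [NormedSpace ℝ X]
    (A : ℝ → X →L[ℝ] X) (K : ℝ) : Prop where
  pos : 0 < K
  continuous : ∀ x, Continuous fun t => A t x
  norm_le : ∀ t, ‖A t‖ ≤ K

namespace IsGenerator

variable {X : Type*} [NormedAddCommGroup X] [NormedSpace ℝ X] {A : ℝ → X →L[ℝ] X} {K : ℝ}

theorem continuous_apply (hA : IsGenerator A K) {y : ℝ → X} (hy : Continuous y) :
    Continuous fun t => A t (y t) :=
  continuous_family_apply hA.continuous continuous_const hA.norm_le hy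

theorem solution_unique (hA : IsGenerator A K) {x y : ℝ → X} {s : ℝ}
    (hx : ∀ t, HasDerivAt x (A t (x t)) t) (hy : ∀ t, HasDerivAt y (A t (y t)) t)
    (h : x s = y s) : x = y :=
  ODE_solution_unique_univ (v := fun t x => A t x) (s := fun _ => univ) (K := ⟨K, hA.pos.le⟩)
    (fun t => ((A t).lipschitz.weaken (hA.norm_le t)).lipschitzOnWith)
    (fun t => ⟨hx t, trivial⟩) (fun t => ⟨hy t, trivial⟩) h

variable [CompleteSpace X]

/-- In the weight `exp(2K|t-s|)` integration gains `1/(2K)`, so the Picard map contracts by `1/2` on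
the whole line at once and no continuation argument is needed. The radius `2‖x₀‖` solves `‖x₀‖ + r/2
= r`. -/
theorem exists_solution (hA : IsGenerator A K) (s : ℝ) (x₀ : X) :
    ∃ x : ℝ → X, x s = x₀ ∧ (∀ t, HasDerivAt x (A t (x t)) t) ∧
      ∀ t, ‖x t‖ ≤ 2 * ‖x₀‖ * Real.exp (2 * K * |t - s|) := by
  have hL : 0 < 2 * K := by linarith [hA.pos]
  have hbound : ∀ (x : ℝ → X) (D : ℝ), 0 ≤ D →
      (∀ t, ‖x t‖ ≤ D * Real.exp (2 * K * |t - s|)) →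
      ∀ t, ‖∫ τ in s..t, A τ (x τ)‖ ≤ 1 / 2 * D * Real.exp (2 * K * |t - s|) := by
    intro x D hD hx t
    have h1 : ‖∫ τ in s..t, A τ (x τ)‖ ≤
        |∫ τ in s..t, K * D * Real.exp (2 * K * |τ - s|)| := by
      refine intervalIntegral.norm_integral_le_abs_of_norm_le (ae_of_all _ fun τ => ?_) ?_
      · refine ((A τ).le_opNorm _).trans ?_
        rw [mul_assoc]
        exact mul_le_mul (hA.norm_le τ) (hx τ) (norm_nonneg _) hA.pos.le
      · exact (by fun_prop : Continuous fun τ => K * D * Real.exp (2 * K * |τ - s|)).intervalIntegrable _ _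
    refine h1.trans ?_
    rw [intervalIntegral.integral_const_mul, abs_mul, abs_of_nonneg (mul_nonneg hA.pos.le hD)]
    refine (mul_le_mul_of_nonneg_left (abs_integral_exp_abs_le hL s t)
      (mul_nonneg hA.pos.le hD)).trans (le_of_eq ?_)
    have := hA.pos.ne'
    field_simp
  have hone : ∀ t, 1 ≤ Real.exp (2 * K * |t - s|) := fun t =>
    Real.one_le_exp (by positivity)
  obtain ⟨x, hx, hxM, hfix⟩ := exists_fixedPoint_of_weight (X := X)
    (wt := fun t => Real.exp (2 * K * |t - s|)) (M := 2 * ‖x₀‖) (q := 1 / 2)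
    (by fun_prop) (fun _ => Real.exp_pos _) (by positivity) (by norm_num) (by norm_num)
    (fun x t => x₀ + ∫ τ in s..t, A τ (x τ))
    (fun x hx _ => continuous_const.add
      (intervalIntegral.continuous_primitive
        (fun a b => (hA.continuous_apply hx).intervalIntegrable a b) s))
    (fun x hx hxM t => by
      have h1 := hbound x _ (by positivity) hxM t
      have h2 := mul_le_mul_of_nonneg_left (hone t) (norm_nonneg x₀)
      have := norm_add_le x₀ (∫ τ in s..t, A τ (x τ))
      linarith)
    (fun x y hx hy _ _ D hD hxy t => by
      have h1 := hbound (fun t => x t - y t) D hD hxy t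
      rw [add_sub_add_left_eq_sub, ← intervalIntegral.integral_sub
        ((hA.continuous_apply hx).intervalIntegrable _ _)
        ((hA.continuous_apply hy).intervalIntegrable _ _)]
      simpa only [map_sub] using h1)
  refine ⟨x, ?_, fun t => ?_, hxM⟩
  · rw [← hfix]; simp
  · have h1 := ((hA.continuous_apply hx).integral_hasStrictDerivAt s t).hasDerivAt.const_add x₀
    conv at h1 => arg 1; change fun t => x₀ + ∫ τ in s..t, A τ (x τ)
    rwa [hfix] at h1

/-- The evolution family of a linear ODE. -/
def evol (hA : IsGenerator A K) (t s : ℝ) : X →L[ℝ] X :=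
  LinearMap.mkContinuous
    { toFun := fun x => (hA.exists_solution s x).choose t
      map_add' := fun x y => by
        have hx := (hA.exists_solution s x).choose_spec
        have hy := (hA.exists_solution s y).choose_spec
        have hxy := (hA.exists_solution s (x + y)).choose_spec
        refine congrFun (hA.solution_unique (s := s) hxy.2.1 (y := fun t =>
          (hA.exists_solution s x).choose t + (hA.exists_solution s y).choose t)
          (fun t => ?_) ?_) t
        · rw [map_add]
          exact (hx.2.1 t).add (hy.2.1 t)
        · rw [hxy.1, hx.1, hy.1]
      map_smul' := fun c x => by
        have hx := (hA.exists_solution s x).choose_spec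
        have hcx := (hA.exists_solution s (c • x)).choose_spec
        refine congrFun (hA.solution_unique (s := s) hcx.2.1 (y := fun t =>
          c • (hA.exists_solution s x).choose t) (fun t => ?_) ?_) t
        · rw [map_smul]
          exact (hx.2.1 t).const_smul c
        · rw [hcx.1, hx.1] }
    (2 * Real.exp (2 * K * |t - s|)) fun x => by
      refine ((hA.exists_solution s x).choose_spec.2.2 t).trans (le_of_eq ?_)
      ring

theorem norm_evol_le (hA : IsGenerator A K) (t s : ℝ) :
    ‖hA.evol t s‖ ≤ 2 * Real.exp (2 * K * |t - s|) :=
  LinearMap.mkContinuous_norm_le _ (by positivity) _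

@[simp]
theorem evol_self (hA : IsGenerator A K) (s : ℝ) (x : X) : hA.evol s s x = x :=
  (hA.exists_solution s x).choose_spec.1

theorem hasDerivAt_evol (hA : IsGenerator A K) (t s : ℝ) (x : X) :
    HasDerivAt (fun t => hA.evol t s x) (A t (hA.evol t s x)) t :=
  (hA.exists_solution s x).choose_spec.2.1 t

theorem evol_evol (hA : IsGenerator A K) (t r s : ℝ) (x : X) :
    hA.evol t r (hA.evol r s x) = hA.evol t s x :=
  congrFun (hA.solution_unique (s := r) (fun t => hA.hasDerivAt_evol t r (hA.evol r s x))
    (fun t => hA.hasDerivAt_evol t s x) (by simp)) t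

theorem continuous_evol_left (hA : IsGenerator A K) (s : ℝ) (x : X) :
    Continuous fun t => hA.evol t s x :=
  continuous_iff_continuousAt.2 fun t => (hA.hasDerivAt_evol t s x).continuousAt

/-- By the cocycle identity, `evol t s x - evol t s₀ x` is `evol t s` applied to `x - evol s s₀ x`,
which reduces continuity in the initial time to continuity in the final time. -/
theorem continuous_evol_right (hA : IsGenerator A K) (t : ℝ) (x : X) :
    Continuous fun s => hA.evol t s x := by
  refine continuous_iff_continuousAt.2 fun s₀ => ?_
  rw [ContinuousAt, tendsto_iff_norm_sub_tendsto_zero]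
  have h1 : Tendsto (fun s => 2 * Real.exp (2 * K * |t - s|) * ‖x - hA.evol s s₀ x‖)
      (𝓝 s₀) (𝓝 0) := by
    have : Continuous fun s => 2 * Real.exp (2 * K * |t - s|) * ‖x - hA.evol s s₀ x‖ :=
      (by fun_prop : Continuous fun s => 2 * Real.exp (2 * K * |t - s|)).mul
        (continuous_const.sub (hA.continuous_evol_left s₀ x)).norm
    simpa using this.tendsto s₀
  refine squeeze_zero (fun _ => norm_nonneg _) (fun s => ?_) h1
  rw [← hA.evol_evol t s s₀ x, ← map_sub]
  exact ((hA.evol t s).le_opNorm _).trans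
    (mul_le_mul_of_nonneg_right (hA.norm_evol_le t s) (norm_nonneg _))

theorem continuous_evol (hA : IsGenerator A K) {Z : Type*} [TopologicalSpace Z] {t s : Z → ℝ}
    {y : Z → X} (ht : Continuous t) (hs : Continuous s) (hy : Continuous y) :
    Continuous fun z => hA.evol (t z) (s z) (y z) := by
  have h1 : Continuous fun z => hA.evol 0 (s z) (y z) :=
    continuous_family_apply (U := fun z => hA.evol 0 (s z))
      (fun x => (hA.continuous_evol_right 0 x).comp hs)
      (by fun_prop : Continuous fun z => 2 * Real.exp (2 * K * |0 - s z|))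
      (fun z => hA.norm_evol_le _ _) hy
  have h2 : Continuous fun z => hA.evol (t z) 0 (hA.evol 0 (s z) (y z)) :=
    continuous_family_apply (U := fun z => hA.evol (t z) 0)
      (fun x => (hA.continuous_evol_left 0 x).comp ht)
      (by fun_prop : Continuous fun z => 2 * Real.exp (2 * K * |t z - 0|))
      (fun z => hA.norm_evol_le _ _) h1
  simpa only [evol_evol] using h2

/-- The solution of the inhomogeneous equation given by the Duhamel formula. -/
def duhamel (hA : IsGenerator A K) (x₀ : X) (g : ℝ → X) (t : ℝ) : X :=
  hA.evol t 0 x₀ + ∫ s in (0 : ℝ)..t, hA.evol t s (g s)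

theorem duhamel_zero (hA : IsGenerator A K) (x₀ : X) (g : ℝ → X) : hA.duhamel x₀ g 0 = x₀ := by
  simp [duhamel]

theorem hasDerivAt_duhamel (hA : IsGenerator A K) (x₀ : X) {g : ℝ → X} (hg : Continuous g)
    (t : ℝ) : HasDerivAt (hA.duhamel x₀ g) (A t (hA.duhamel x₀ g t) + g t) t := by
  have hc : Continuous fun s => hA.evol 0 s (g s) :=
    hA.continuous_evol continuous_const continuous_id hg
  -- Pulling `evol t 0` out of the integral leaves an ordinary primitive, to which the product rule
  -- for families applies.
  have e : hA.duhamel x₀ g =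
      fun t => hA.evol t 0 (x₀ + ∫ s in (0 : ℝ)..t, hA.evol 0 s (g s)) := by
    ext t
    rw [map_add, ← (hA.evol t 0).intervalIntegral_comp_comm (hc.intervalIntegrable _ _)]
    simp only [evol_evol, duhamel]
  have hy : HasDerivAt (fun t => x₀ + ∫ s in (0 : ℝ)..t, hA.evol 0 s (g s))
      (hA.evol 0 t (g t)) t := (hc.integral_hasStrictDerivAt 0 t).hasDerivAt.const_add x₀
  have := hasDerivWithinAt_family_apply (U := fun t => hA.evol t 0) (S := univ)
    (fun x => hA.continuous_evol_left 0 x)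
    (by fun_prop : Continuous fun t => 2 * Real.exp (2 * K * |t - 0|))
    (fun t => hA.norm_evol_le t 0) hy.hasDerivWithinAt
    (hA.hasDerivAt_evol t 0 _).hasDerivWithinAt
  rw [hasDerivWithinAt_univ, evol_evol, evol_self] at this
  rw [e]
  exact this

end IsGenerator

/-! ### Weighted energy estimates for the linear damped wave equation. -/

/-- `w` solves the linear damped wave equation on `[s, ∞)` and `v` is its time derivative. -/
structure IsLinearSolution (μ s : ℝ) (w : ℝ → Sobolev 2) (v : ℝ → Sobolev 1) : Prop where
  hasDeriv : ∀ t ∈ Ici s, HasDerivWithinAt (fun t => incl (w t)) (v t) (Ici s) t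
  hasDeriv_velocity : ∀ t ∈ Ici s, HasDerivWithinAt (fun t => toL2 (v t))
    (toL2 (dx (dx (w t))) - (μ / (1 + t)) • toL2 (v t)) (Ici s) t

namespace IsLinearSolution

variable {μ s : ℝ} {w w' : ℝ → Sobolev 2} {v v' : ℝ → Sobolev 1}

theorem sub (h : IsLinearSolution μ s w v) (h' : IsLinearSolution μ s w' v') :
    IsLinearSolution μ s (fun t => w t - w' t) (fun t => v t - v' t) where
  hasDeriv t ht := (h.hasDeriv t ht).sub (h'.hasDeriv t ht)
  hasDeriv_velocity t ht := by
    refine ((h.hasDeriv_velocity t ht).sub (h'.hasDeriv_velocity t ht)).congr_deriv ?_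
    have e1 : toL2 (dx (dx (w t - w' t))) = toL2 (dx (dx (w t))) - toL2 (dx (dx (w' t))) := rfl
    have e2 : toL2 (v t - v' t) = toL2 (v t) - toL2 (v' t) := rfl
    rw [e1, e2, smul_sub]
    abel

theorem transl (h : IsLinearSolution μ s w v) (r : ℝ) :
    IsLinearSolution μ s (fun t => Sobolev.transl r (w t)) (fun t => Sobolev.transl r (v t)) where
  hasDeriv t ht := (Sobolev.transl r).toContinuousLinearMap.hasFDerivAt.comp_hasDerivWithinAt t
    (h.hasDeriv t ht)
  hasDeriv_velocity t ht := by
    refine ((DampedWave.transl r).toContinuousLinearMap.hasFDerivAt.comp_hasDerivWithinAt t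
      (h.hasDeriv_velocity t ht)).congr_deriv ?_
    rw [map_sub, map_smul]
    rfl

/-- The weighted energy density used in the decay estimate. -/
def energy (μ β : ℝ) (w : ℝ → Sobolev 2) (v : ℝ → Sobolev 1) (t : ℝ) : ℝ :=
  1 / 2 * (‖(v t).1 0‖ ^ 2 + ‖(w t).1 1‖ ^ 2) +
    β / 2 * ((1 + t)⁻¹ * inner ℝ ((w t).1 0) ((v t).1 0)) +
    β / 4 * (μ + 1 - β) * ((1 + t)⁻¹ ^ 2 * ‖(w t).1 0‖ ^ 2)

theorem hasDerivWithinAt_coord (h : IsLinearSolution μ s w v) {t : ℝ} (ht : t ∈ Ici s)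
    (i : Fin 2) : HasDerivWithinAt (fun t => (w t).1 i.castSucc) ((v t).1 i) (Ici s) t :=
  (Sobolev.proj 1 i).hasFDerivAt.comp_hasDerivWithinAt t (h.hasDeriv t ht)

/-- The coefficients in `energy` are exactly those for which, after integration by parts, the
contributions of `‖∂ₓw‖²` and of `⟨w, v⟩` cancel. The two remaining terms are nonpositive for `β ≤
μ` and `β ≤ 2`. -/
theorem hasDerivWithinAt_energy (h : IsLinearSolution μ s w v) (β : ℝ) {t : ℝ} (ht : t ∈ Ici s)
    (hs : 0 ≤ s) :
    HasDerivWithinAt (fun t => (1 + t) ^ β * energy μ β w v t)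
      ((1 + t) ^ β * (1 + t)⁻¹ * ((β - μ) * ‖(v t).1 0‖ ^ 2 +
        β / 4 * (μ + 1 - β) * (β - 2) * ((1 + t)⁻¹ ^ 2 * ‖(w t).1 0‖ ^ 2))) (Ici s) t := by
  have hτ : 0 < 1 + t := by linarith [show s ≤ t from ht]
  have hw0 := h.hasDerivWithinAt_coord ht 0
  have hw1 := h.hasDerivWithinAt_coord ht 1
  have hv0 := h.hasDeriv_velocity t ht
  have hi1 : HasDerivWithinAt (fun t : ℝ => (1 + t)⁻¹) (-1 / (1 + t) ^ 2) (Ici s) t :=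
    (((hasDerivAt_id t).const_add 1).inv hτ.ne').hasDerivWithinAt
  have hp : HasDerivWithinAt (fun t : ℝ => (1 + t) ^ β) (1 * β * (1 + t) ^ (β - 1)) (Ici s) t :=
    (((hasDerivAt_id t).const_add 1).rpow_const (Or.inl hτ.ne')).hasDerivWithinAt
  have main := hp.mul ((((hv0.norm_sq.add hw1.norm_sq).const_mul (1 / 2)).add
    ((hi1.mul (hw0.inner ℝ hv0)).const_mul (β / 2))).add
    (((hi1.pow 2).mul hw0.norm_sq).const_mul (β / 4 * (μ + 1 - β))))
  refine main.congr_deriv ?_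
  have ibp1 : inner ℝ ((w t).1 2) ((v t).1 0) + inner ℝ ((w t).1 1) ((v t).1 1) = 0 :=
    HasWeakDeriv.inner_add_inner ((w t).2 1) (Sobolev.hasWeakDeriv (v t))
  have ibp2 : inner ℝ ((w t).1 1) ((w t).1 1) + inner ℝ ((w t).1 0) ((w t).1 2) = 0 :=
    HasWeakDeriv.inner_add_inner ((w t).2 0) ((w t).2 1)
  rw [real_inner_self_eq_norm_sq] at ibp2
  have ew2 : toL2 (dx (dx (w t))) = (w t).1 2 := rfl
  have ev0 : toL2 (v t) = (v t).1 0 := rfl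
  have ec0 : (w t).1 (Fin.castSucc 0) = (w t).1 0 := rfl
  have ec1 : (w t).1 (Fin.castSucc 1) = (w t).1 1 := rfl
  have er : (1 + t) ^ (β - 1) = (1 + t) ^ β * (1 + t)⁻¹ := by
    rw [Real.rpow_sub hτ, Real.rpow_one, div_eq_mul_inv]
  have ei : inner ℝ ((v t).1 0) ((w t).1 2) = -inner ℝ ((w t).1 1) ((v t).1 1) := by
    rw [real_inner_comm]; linarith
  have ei2 : inner ℝ ((w t).1 0) ((w t).1 2) = -‖(w t).1 1‖ ^ 2 := by linarith
  simp only [Pi.add_apply, Pi.mul_apply, Pi.pow_apply, ew2, ev0, ec0, ec1, inner_sub_right,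
    inner_smul_right, real_inner_self_eq_norm_sq, ei, ei2, er, div_eq_mul_inv, ← inv_pow]
  generalize (1 + t)⁻¹ = y
  push_cast
  ring

theorem antitoneOn_energy (h : IsLinearSolution μ s w v) {β : ℝ} (hβ : 0 < β) (hβμ : β ≤ μ)
    (hβ2 : β ≤ 2) (hs : 0 ≤ s) :
    AntitoneOn (fun t => (1 + t) ^ β * energy μ β w v t) (Ici s) := by
  have hd := fun t (ht : t ∈ Ici s) => h.hasDerivWithinAt_energy β ht hs
  refine antitoneOn_of_hasDerivWithinAt_nonpos (convex_Ici s)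
    (fun t ht => (hd t ht).continuousWithinAt)
    (fun t ht => (hd t (interior_subset ht)).mono interior_subset) fun t ht => ?_
  have hτ : 0 < 1 + t := by linarith [show s ≤ t from interior_subset ht]
  refine mul_nonpos_of_nonneg_of_nonpos (by positivity) ?_
  have h1 : (β - μ) * ‖(v t).1 0‖ ^ 2 ≤ 0 :=
    mul_nonpos_of_nonpos_of_nonneg (by linarith) (by positivity)
  have h2 : β / 4 * (μ + 1 - β) * (β - 2) * ((1 + t)⁻¹ ^ 2 * ‖(w t).1 0‖ ^ 2) ≤ 0 := by
    refine mul_nonpos_of_nonpos_of_nonneg ?_ (by positivity)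
    exact mul_nonpos_of_nonneg_of_nonpos (mul_nonneg (by positivity) (by linarith)) (by linarith)
  linarith

/-- The unweighted quantity controlled by the energy. -/
def size (w : ℝ → Sobolev 2) (v : ℝ → Sobolev 1) (t : ℝ) : ℝ :=
  ‖(v t).1 0‖ ^ 2 + ‖(w t).1 1‖ ^ 2 + (1 + t)⁻¹ ^ 2 * ‖(w t).1 0‖ ^ 2

theorem abs_cross_le (w : ℝ → Sobolev 2) (v : ℝ → Sobolev 1) {t : ℝ} (ht : 0 < 1 + t) :
    |(1 + t)⁻¹ * inner ℝ ((w t).1 0) ((v t).1 0)| ≤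
      ((1 + t)⁻¹ * ‖(w t).1 0‖) * ‖(v t).1 0‖ := by
  rw [abs_mul, abs_of_pos (inv_pos.2 ht), mul_assoc]
  exact mul_le_mul_of_nonneg_left (abs_real_inner_le_norm _ _) (inv_pos.2 ht).le

/-- Completing the square in the cross term leaves the coefficient `δ = β/4 (μ + 1 - 3β/2)` in front
of `(1+t)⁻²‖w‖²`; it is positive precisely under `h3`. -/
theorem size_le {β : ℝ} (hβ : 0 < β) (h3 : 3 * β / 2 < μ + 1)
    (w : ℝ → Sobolev 2) (v : ℝ → Sobolev 1) {t : ℝ} (ht : 0 < 1 + t) :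
    size w v t ≤ (4 + (β ^ 2 / 2 + 1) / (β / 4 * (μ + 1 - β) - β ^ 2 / 8)) * energy μ β w v t := by
  have hδ : 0 < β / 4 * (μ + 1 - β) - β ^ 2 / 8 := by nlinarith
  have hc := neg_le_of_abs_le (abs_cross_le w v ht)
  unfold size energy
  rw [← mul_pow]
  generalize (1 + t)⁻¹ * inner ℝ ((w t).1 0) ((v t).1 0) = x at *
  generalize (1 + t)⁻¹ * ‖(w t).1 0‖ = b at *
  generalize ‖(v t).1 0‖ = a at *
  generalize ‖(w t).1 1‖ = q at *
  set δ := β / 4 * (μ + 1 - β) - β ^ 2 / 8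
  have eδ : β / 4 * (μ + 1 - β) = δ + β ^ 2 / 8 := by simp only [δ]; ring
  rw [eδ]
  have l1 : 1 / 2 * (a - β / 2 * b) ^ 2 + δ * b ^ 2 + 1 / 2 * q ^ 2 ≤
      1 / 2 * (a ^ 2 + q ^ 2) + β / 2 * x + (δ + β ^ 2 / 8) * b ^ 2 := by
    have := mul_le_mul_of_nonneg_left hc (by positivity : 0 ≤ β / 2)
    nlinarith
  have hK : 0 < (β ^ 2 / 2 + 1) / δ := by positivity
  refine le_trans ?_ (mul_le_mul_of_nonneg_left l1 (by positivity))
  have e1 : (β ^ 2 / 2 + 1) / δ * (δ * b ^ 2) = (β ^ 2 / 2 + 1) * b ^ 2 := by field_simp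
  have p1 : 0 ≤ (β ^ 2 / 2 + 1) / δ * (1 / 2 * (a - β / 2 * b) ^ 2 + 1 / 2 * q ^ 2) := by positivity
  have p2 : 0 ≤ δ * b ^ 2 := by positivity
  -- Here `a² ≤ 2(a - βb/2)² + β²b²/2`: the `4` pays for the square, and the quotient by `δ` pays
  -- for `(β²/2 + 1)b²`.
  nlinarith [sq_nonneg (a - β * b), sq_nonneg q]

theorem energy_le {β : ℝ} (hβ : 0 < β) (h3 : 3 * β / 2 < μ + 1)
    (w : ℝ → Sobolev 2) (v : ℝ → Sobolev 1) {t : ℝ} (ht : 0 < 1 + t) :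
    energy μ β w v t ≤ (1 / 2 + β / 4 + β / 4 * (μ + 1 - β)) * size w v t := by
  have hc := le_of_abs_le (abs_cross_le w v ht)
  unfold size energy
  rw [← mul_pow]
  generalize (1 + t)⁻¹ * inner ℝ ((w t).1 0) ((v t).1 0) = x at *
  generalize (1 + t)⁻¹ * ‖(w t).1 0‖ = b at *
  generalize ‖(v t).1 0‖ = a at *
  generalize ‖(w t).1 1‖ = q at *
  have hκ : 0 < β / 4 * (μ + 1 - β) := mul_pos (by positivity) (by linarith)
  generalize β / 4 * (μ + 1 - β) = κ at *
  have h1 : β / 2 * x ≤ β / 4 * (a ^ 2 + b ^ 2) := by nlinarith [sq_nonneg (a - b)]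
  have h2 : 0 ≤ β / 4 * q ^ 2 := by positivity
  have h4 : 0 ≤ κ * (a ^ 2 + q ^ 2) := by positivity
  nlinarith [sq_nonneg b]

theorem exists_size_le {β : ℝ} (hβ : 0 < β) (hβμ : β ≤ μ) (hβ2 : β ≤ 2)
    (h3 : 3 * β / 2 < μ + 1) : ∃ K, 0 < K ∧ ∀ (s : ℝ) (w : ℝ → Sobolev 2) (v : ℝ → Sobolev 1),
      0 ≤ s → IsLinearSolution μ s w v → ∀ t, s ≤ t →
        (1 + t) ^ β * size w v t ≤ K * ((1 + s) ^ β * size w v s) := by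
  set K₁ := 4 + (β ^ 2 / 2 + 1) / (β / 4 * (μ + 1 - β) - β ^ 2 / 8)
  set K₂ := 1 / 2 + β / 4 + β / 4 * (μ + 1 - β)
  have hδ : 0 < β / 4 * (μ + 1 - β) - β ^ 2 / 8 := by nlinarith
  have hK₁ : 0 < K₁ := by positivity
  have hK₂ : 0 < K₂ := by
    have : 0 < β / 4 * (μ + 1 - β) := mul_pos (by positivity) (by linarith)
    positivity
  refine ⟨K₁ * K₂, mul_pos hK₁ hK₂, fun s w v hs h t ht => ?_⟩
  have hσ : 0 < 1 + s := by linarith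
  have hτ : 0 < 1 + t := by linarith
  have h1 := h.antitoneOn_energy hβ hβμ hβ2 hs self_mem_Ici (mem_Ici.2 ht) ht
  calc (1 + t) ^ β * size w v t ≤ (1 + t) ^ β * (K₁ * energy μ β w v t) :=
        mul_le_mul_of_nonneg_left (size_le hβ h3 w v hτ) (by positivity)
    _ = K₁ * ((1 + t) ^ β * energy μ β w v t) := by ring
    _ ≤ K₁ * ((1 + s) ^ β * energy μ β w v s) := mul_le_mul_of_nonneg_left h1 hK₁.le
    _ ≤ K₁ * ((1 + s) ^ β * (K₂ * size w v s)) := by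
        refine mul_le_mul_of_nonneg_left (mul_le_mul_of_nonneg_left
          (energy_le hβ h3 w v hσ) (by positivity)) hK₁.le
    _ = _ := by ring

end IsLinearSolution

theorem HasWeakDeriv.tendsto_norm_sq {a g : L2} (H : HasWeakDeriv a g) :
    Tendsto (fun h : ℝ => h⁻¹ ^ 2 * ‖DampedWave.transl h a - a‖ ^ 2) (𝓝[≠] 0) (𝓝 (‖g‖ ^ 2)) := by
  have h1 := ((hasDerivAt_iff_tendsto_slope_zero.1 (H.hasDerivAt 0)).norm).pow 2
  simp only [zero_add, transl_zero, norm_smul, mul_pow] at h1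
  simpa using h1

/-- The weighted norm `(1+t)⁻¹ ‖w‖_{L²} + ‖∂ₓw‖_{H¹} + ‖v‖_{H¹}` appearing in the decay
estimate. -/
def decayNorm (t : ℝ) (w : Sobolev 2) (v : Sobolev 1) : ℝ :=
  (1 + t)⁻¹ * ‖toL2 w‖ + ‖dx w‖ + ‖v‖

theorem decayNorm_eq (t : ℝ) (w : Sobolev 2) (v : Sobolev 1) :
    decayNorm t w v =
      (1 + t)⁻¹ * ‖w.1 0‖ + (‖w.1 1‖ + ‖w.1 2‖) + (‖v.1 0‖ + ‖v.1 1‖) := by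
  unfold decayNorm
  rw [Sobolev.norm_one_eq, Sobolev.norm_one_eq]
  rfl

namespace IsLinearSolution

variable {μ s : ℝ} {w w' : ℝ → Sobolev 2} {v v' : ℝ → Sobolev 1}

/-- The quantity `size` for the spatial derivative. -/
def sizeDeriv (w : ℝ → Sobolev 2) (v : ℝ → Sobolev 1) (t : ℝ) : ℝ :=
  ‖(v t).1 1‖ ^ 2 + ‖(w t).1 2‖ ^ 2 + (1 + t)⁻¹ ^ 2 * ‖(w t).1 1‖ ^ 2

theorem tendsto_size (w : ℝ → Sobolev 2) (v : ℝ → Sobolev 1) (t : ℝ) :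
    Tendsto (fun h : ℝ => h⁻¹ ^ 2 * size (fun t => Sobolev.transl h (w t) - w t)
      (fun t => Sobolev.transl h (v t) - v t) t) (𝓝[≠] 0) (𝓝 (sizeDeriv w v t)) := by
  have h1 := (Sobolev.hasWeakDeriv (v t)).tendsto_norm_sq
  have h2 := ((w t).2 1).tendsto_norm_sq
  have h3 := (((w t).2 0).tendsto_norm_sq).const_mul ((1 + t)⁻¹ ^ 2)
  refine ((h1.add h2).add h3).congr fun h => ?_
  simp only [size]
  rw [mul_add, mul_add, mul_left_comm]
  rfl

/-- The equation commutes with translations, so `exists_size_le` applies to `transl r w - w`;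
dividing by `r²` and letting `r → 0` gives the same estimate for the spatial derivative. In `10 K`,
the `5` is Cauchy-Schwarz for five summands, and the `2` absorbs `(1+s)⁻²‖∂ₓw‖²`, which occurs
besides `‖∂ₓw‖²`. -/
theorem exists_decayNorm_le {β : ℝ} (hβ : 0 < β) (hβμ : β ≤ μ) (hβ2 : β ≤ 2)
    (h3 : 3 * β / 2 < μ + 1) : ∃ K, 0 < K ∧ ∀ (s : ℝ) (w : ℝ → Sobolev 2) (v : ℝ → Sobolev 1),
      0 ≤ s → IsLinearSolution μ s w v → ∀ t, s ≤ t →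
        decayNorm t (w t) (v t) ≤
          K * ((1 + s) / (1 + t)) ^ (β / 2) * decayNorm s (w s) (v s) := by
  obtain ⟨K, hK, hsize⟩ := exists_size_le hβ hβμ hβ2 h3
  refine ⟨√(10 * K), by positivity, fun s w v hs h t ht => ?_⟩
  have hσ : 0 < 1 + s := by linarith
  have hτ : 0 < 1 + t := by linarith
  have hl := hsize s w v hs h t ht
  have hh : (1 + t) ^ β * sizeDeriv w v t ≤ K * ((1 + s) ^ β * sizeDeriv w v s) := by
    refine le_of_tendsto_of_tendsto' ((tendsto_size w v t).const_mul ((1 + t) ^ β))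
      (((tendsto_size w v s).const_mul ((1 + s) ^ β)).const_mul K) fun r => ?_
    have h1 := mul_le_mul_of_nonneg_left
      (hsize s _ _ hs ((h.transl r).sub h) t ht) (sq_nonneg r⁻¹)
    calc _ = r⁻¹ ^ 2 * ((1 + t) ^ β * size (fun t => Sobolev.transl r (w t) - w t)
      (fun t => Sobolev.transl r (v t) - v t) t) := by ring
      _ ≤ _ := h1
      _ = _ := by ring
  have hle : (1 + s)⁻¹ ≤ 1 := inv_le_one_of_one_le₀ (by linarith)
  have hi : 0 ≤ (1 + s)⁻¹ := by positivity
  have hit : 0 ≤ (1 + t)⁻¹ := by positivity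
  have hD : ∀ t, 0 < 1 + t → 0 ≤ decayNorm t (w t) (v t) := fun t ht => by
    unfold decayNorm; positivity
  have lower : decayNorm t (w t) (v t) ^ 2 ≤ 5 * (size w v t + sizeDeriv w v t) := by
    rw [decayNorm_eq]
    unfold size sizeDeriv
    rw [← mul_pow, ← mul_pow]
    have : 0 ≤ ((1 + t)⁻¹ * ‖(w t).1 1‖) ^ 2 := by positivity
    generalize (1 + t)⁻¹ * ‖(w t).1 0‖ = a at *
    generalize ‖(w t).1 1‖ = b at *
    generalize ‖(w t).1 2‖ = c at *
    generalize ‖(v t).1 0‖ = d at *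
    generalize ‖(v t).1 1‖ = e at *
    nlinarith [sq_nonneg (a - b), sq_nonneg (a - c), sq_nonneg (a - d), sq_nonneg (a - e),
      sq_nonneg (b - c), sq_nonneg (b - d), sq_nonneg (b - e), sq_nonneg (c - d),
      sq_nonneg (c - e), sq_nonneg (d - e)]
  have upper : size w v s + sizeDeriv w v s ≤ 2 * decayNorm s (w s) (v s) ^ 2 := by
    rw [decayNorm_eq]
    unfold size sizeDeriv
    have hb : (1 + s)⁻¹ ^ 2 * ‖(w s).1 1‖ ^ 2 ≤ ‖(w s).1 1‖ ^ 2 :=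
      mul_le_of_le_one_left (by positivity) (pow_le_one₀ hi hle)
    rw [← mul_pow (1 + s)⁻¹ ‖(w s).1 0‖]
    have ha : 0 ≤ (1 + s)⁻¹ * ‖(w s).1 0‖ := by positivity
    generalize (1 + s)⁻¹ * ‖(w s).1 0‖ = a at *
    have h1 := norm_nonneg ((w s).1 1)
    have h2 := norm_nonneg ((w s).1 2)
    have h3 := norm_nonneg ((v s).1 0)
    have h4 := norm_nonneg ((v s).1 1)
    generalize ‖(w s).1 1‖ = b at *
    generalize ‖(w s).1 2‖ = c at *
    generalize ‖(v s).1 0‖ = d at *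
    generalize ‖(v s).1 1‖ = e at *
    have : a ^ 2 + b ^ 2 + c ^ 2 + d ^ 2 + e ^ 2 ≤ (a + (b + c) + (d + e)) ^ 2 := by
      have : 0 ≤ a * (b + c + d + e) := by positivity
      have : 0 ≤ b * (c + d + e) := by positivity
      have : 0 ≤ c * (d + e) + d * e := by positivity
      nlinarith
    nlinarith
  refine (sq_le_sq₀ (hD t hτ) (by have := hD s hσ; positivity)).1 ?_
  rw [mul_pow, mul_pow, Real.sq_sqrt (by positivity), ← Real.rpow_natCast (((1 + s) / (1 + t)) ^ _),
    ← Real.rpow_mul (by positivity)]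
  have e2 : β / 2 * (2 : ℕ) = β := by push_cast; ring
  rw [e2, Real.div_rpow hσ.le hτ.le]
  have hτβ : 0 < (1 + t) ^ β := by positivity
  have hσβ : 0 < (1 + s) ^ β := by positivity
  rw [mul_div_assoc', div_mul_eq_mul_div, le_div_iff₀ hτβ]
  calc decayNorm t (w t) (v t) ^ 2 * (1 + t) ^ β
      ≤ 5 * (size w v t + sizeDeriv w v t) * (1 + t) ^ β :=
        mul_le_mul_of_nonneg_right lower hτβ.le
    _ = 5 * ((1 + t) ^ β * size w v t + (1 + t) ^ β * sizeDeriv w v t) := by ring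
    _ ≤ 5 * (K * ((1 + s) ^ β * size w v s) + K * ((1 + s) ^ β * sizeDeriv w v s)) := by gcongr
    _ = 5 * K * (1 + s) ^ β * (size w v s + sizeDeriv w v s) := by ring
    _ ≤ 5 * K * (1 + s) ^ β * (2 * decayNorm s (w s) (v s) ^ 2) := by gcongr
    _ = _ := by ring

/-- The decay estimate is applied to the difference, whose data vanish. Any admissible exponent
serves, and `min μ 1` is admissible for every positive `μ`. -/
theorem unique (hμ : 0 < μ) (hs : 0 ≤ s) (h : IsLinearSolution μ s w v)
    (h' : IsLinearSolution μ s w' v') (hw : w s = w' s) (hv : v s = v' s) {t : ℝ} (ht : s ≤ t) :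
    w t = w' t := by
  obtain ⟨K, hK, hdecay⟩ := exists_decayNorm_le (μ := μ) (β := min μ 1) (by positivity)
    (min_le_left _ _) ((min_le_right _ _).trans (by norm_num)) (by
      have h1 := min_le_left μ 1
      have h2 := min_le_right μ 1
      linarith)
  have h1 := hdecay s _ _ hs (h.sub h') t ht
  rw [hw, hv, sub_self, sub_self] at h1
  have hτ : 0 < (1 + t)⁻¹ := inv_pos.2 (by linarith)
  have e0 : toL2 (0 : Sobolev 2) = 0 := rfl
  have e1 : dx (0 : Sobolev 2) = 0 := rfl
  simp only [decayNorm, e0, e1, norm_zero, mul_zero, add_zero] at h1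
  have h2 : (1 + t)⁻¹ * ‖toL2 (w t - w' t)‖ ≤ 0 := by
    linarith [norm_nonneg (dx (w t - w' t)), norm_nonneg (v t - v' t)]
  have h3 : ‖toL2 (w t - w' t)‖ ≤ 0 := by
    by_contra hc
    exact absurd h2 (not_le.2 (mul_pos hτ (not_le.1 hc)))
  exact sub_eq_zero.1 (Sobolev.ext_toL2 (norm_le_zero_iff.1 h3))

end IsLinearSolution

/-! ### The first order system in Riemann invariants. -/

/-- The state space of the first order system: `(w, ρ, l)` where `ρ` and `l` are the Riemann
invariants `∂ₜw + ∂ₓw` and `∂ₜw - ∂ₓw`, transported back along the characteristics. -/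
abbrev State : Type := Sobolev 1 × Sobolev 1 × Sobolev 1

/-- The velocity `∂ₜw` of a state at time `t`. -/
def velocity (t : ℝ) : State →L[ℝ] Sobolev 1 :=
  (1 / 2 : ℝ) • ((Sobolev.transl t).toContinuousLinearMap ∘L
      (ContinuousLinearMap.fst ℝ (Sobolev 1) (Sobolev 1) ∘L
        ContinuousLinearMap.snd ℝ (Sobolev 1) (Sobolev 1 × Sobolev 1)) +
    (Sobolev.transl (-t)).toContinuousLinearMap ∘L
      (ContinuousLinearMap.snd ℝ (Sobolev 1) (Sobolev 1) ∘L
        ContinuousLinearMap.snd ℝ (Sobolev 1) (Sobolev 1 × Sobolev 1)))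

/-- The spatial derivative `∂ₓw` of a state at time `t`. -/
def slope (t : ℝ) : State →L[ℝ] Sobolev 1 :=
  (1 / 2 : ℝ) • ((Sobolev.transl t).toContinuousLinearMap ∘L
      (ContinuousLinearMap.fst ℝ (Sobolev 1) (Sobolev 1) ∘L
        ContinuousLinearMap.snd ℝ (Sobolev 1) (Sobolev 1 × Sobolev 1)) -
    (Sobolev.transl (-t)).toContinuousLinearMap ∘L
      (ContinuousLinearMap.snd ℝ (Sobolev 1) (Sobolev 1) ∘L
        ContinuousLinearMap.snd ℝ (Sobolev 1) (Sobolev 1 × Sobolev 1)))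

/-- The state at time `t` with vanishing `w` and prescribed velocity. -/
def impulse (t : ℝ) : Sobolev 1 →L[ℝ] State :=
  (0 : Sobolev 1 →L[ℝ] Sobolev 1).prod
    ((Sobolev.transl (-t)).toContinuousLinearMap.prod (Sobolev.transl t).toContinuousLinearMap)

theorem velocity_apply (t : ℝ) (x : State) :
    velocity t x = (1 / 2 : ℝ) • (Sobolev.transl t x.2.1 + Sobolev.transl (-t) x.2.2) := rfl

theorem slope_apply (t : ℝ) (x : State) :
    slope t x = (1 / 2 : ℝ) • (Sobolev.transl t x.2.1 - Sobolev.transl (-t) x.2.2) := rfl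

theorem impulse_apply (t : ℝ) (g : Sobolev 1) :
    impulse t g = (0, Sobolev.transl (-t) g, Sobolev.transl t g) := rfl

theorem velocity_impulse (t : ℝ) (g : Sobolev 1) : velocity t (impulse t g) = g := by
  rw [velocity_apply, impulse_apply]
  simp only [Sobolev.transl_transl_neg, Sobolev.transl_neg_transl]
  rw [← two_smul ℝ g, smul_smul]; norm_num

theorem slope_impulse (t : ℝ) (g : Sobolev 1) : slope t (impulse t g) = 0 := by
  rw [slope_apply, impulse_apply]; simp

theorem norm_velocity_le (t : ℝ) : ‖velocity t‖ ≤ 1 := by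
  refine ContinuousLinearMap.opNorm_le_bound _ zero_le_one fun x => ?_
  rw [velocity_apply, norm_smul, one_mul]
  have h1 := norm_add_le (Sobolev.transl t x.2.1) (Sobolev.transl (-t) x.2.2)
  rw [LinearIsometry.norm_map, LinearIsometry.norm_map] at h1
  have h2 : ‖x.2.1‖ ≤ ‖x‖ := (norm_fst_le x.2).trans (norm_snd_le x)
  have h3 : ‖x.2.2‖ ≤ ‖x‖ := (norm_snd_le x.2).trans (norm_snd_le x)
  rw [Real.norm_of_nonneg (by norm_num)]
  linarith

theorem norm_impulse_le (t : ℝ) : ‖impulse t‖ ≤ 1 := by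
  refine ContinuousLinearMap.opNorm_le_bound _ zero_le_one fun g => ?_
  rw [impulse_apply, Prod.norm_mk, Prod.norm_mk, LinearIsometry.norm_map,
    LinearIsometry.norm_map, one_mul, norm_zero, max_self]
  exact max_le (norm_nonneg _) le_rfl

section Continuity

variable {Z : Type*} [TopologicalSpace Z] {t : Z → ℝ}

theorem continuous_velocity (ht : Continuous t) {x : Z → State} (hx : Continuous x) :
    Continuous fun z => velocity (t z) (x z) :=
  ((Sobolev.continuous_transl ht hx.snd.fst).add
    (Sobolev.continuous_transl ht.neg hx.snd.snd)).const_smul (1 / 2 : ℝ)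

theorem continuous_slope (ht : Continuous t) {x : Z → State} (hx : Continuous x) :
    Continuous fun z => slope (t z) (x z) :=
  ((Sobolev.continuous_transl ht hx.snd.fst).sub
    (Sobolev.continuous_transl ht.neg hx.snd.snd)).const_smul (1 / 2 : ℝ)

theorem continuous_impulse (ht : Continuous t) {g : Z → Sobolev 1} (hg : Continuous g) :
    Continuous fun z => impulse (t z) (g z) :=
  continuous_const.prodMk
    ((Sobolev.continuous_transl ht.neg hg).prodMk (Sobolev.continuous_transl ht hg))

end Continuity

/-- The damping coefficient, extended to negative times. -/
def damping (μ t : ℝ) : ℝ := μ / (1 + |t|)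

theorem continuous_damping (μ : ℝ) : Continuous (damping μ) :=
  continuous_const.div (by fun_prop) fun t => by positivity

theorem damping_of_nonneg (μ : ℝ) {t : ℝ} (ht : 0 ≤ t) : damping μ t = μ / (1 + t) := by
  rw [damping, abs_of_nonneg ht]

/-- The generator of the first order system. -/
def generator (μ t : ℝ) : State →L[ℝ] State :=
  ContinuousLinearMap.inl ℝ _ _ ∘L velocity t - damping μ t • (impulse t ∘L velocity t)

theorem generator_apply (μ t : ℝ) (x : State) :
    generator μ t x = (velocity t x, 0) - damping μ t • impulse t (velocity t x) := rfl

/-- Transport along characteristics has removed `∂ₓ`: only translations, which are isometries, and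
the bounded damping factor remain, so the generator loses no derivative. -/
theorem isGenerator (μ : ℝ) (hμ : 0 < μ) : IsGenerator (generator μ) (1 + μ) where
  pos := by linarith
  continuous x := by
    have hv : Continuous fun t => velocity t x := continuous_velocity continuous_id continuous_const
    exact (hv.prodMk continuous_const).sub
      ((continuous_damping μ).smul (continuous_impulse continuous_id hv))
  norm_le t := by
    refine ContinuousLinearMap.opNorm_le_bound _ (by linarith) fun x => ?_
    rw [generator_apply]
    have hv : ‖velocity t x‖ ≤ ‖x‖ := by
      simpa using (velocity t).le_of_opNorm_le (norm_velocity_le t) x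
    have hi : ‖impulse t (velocity t x)‖ ≤ ‖x‖ := by
      have := (impulse t).le_of_opNorm_le (norm_impulse_le t) (velocity t x)
      rw [one_mul] at this
      exact this.trans hv
    have hd : |damping μ t| ≤ μ := by
      unfold damping
      rw [abs_of_nonneg (by positivity)]
      exact div_le_self hμ.le (by linarith [abs_nonneg t])
    refine (norm_sub_le _ _).trans ?_
    rw [norm_smul, Prod.norm_mk, norm_zero, max_eq_left (norm_nonneg _), add_mul, one_mul]
    exact add_le_add hv (mul_le_mul hd hi (norm_nonneg _) hμ.le)

/-- The state `x` at time `t` comes from an element of `H²(ℝ)`. -/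
def IsCompatible (t : ℝ) (x : State) : Prop := x.1.1 1 = (slope t x).1 0

open Classical in
/-- The element of `H²(ℝ)` given by a compatible state. -/
def State.toSobolev (t : ℝ) (x : State) : Sobolev 2 :=
  if h : HasWeakDeriv (toL2 x.1) (toL2 (slope t x)) then Sobolev.mkTwo _ _ h else 0

theorem IsCompatible.toSobolev_eq {t : ℝ} {x : State} (h : IsCompatible t x) :
    ∃ h', x.toSobolev t = Sobolev.mkTwo (toL2 x.1) (slope t x) h' := by
  have h' : HasWeakDeriv (toL2 x.1) (toL2 (slope t x)) := by
    have := Sobolev.hasWeakDeriv x.1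
    rw [h] at this
    exact this
  exact ⟨h', dif_pos h'⟩

theorem IsCompatible.toL2_toSobolev {t : ℝ} {x : State} (h : IsCompatible t x) :
    toL2 (x.toSobolev t) = toL2 x.1 := by
  obtain ⟨h', e⟩ := h.toSobolev_eq
  rw [e]; rfl

theorem IsCompatible.incl_toSobolev {t : ℝ} {x : State} (h : IsCompatible t x) :
    incl (x.toSobolev t) = x.1 :=
  Sobolev.ext_toL2 h.toL2_toSobolev

theorem IsCompatible.dx_toSobolev {t : ℝ} {x : State} (h : IsCompatible t x) :
    dx (x.toSobolev t) = slope t x := by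
  obtain ⟨h', e⟩ := h.toSobolev_eq
  rw [e]
  exact Sobolev.ext_toL2 rfl

theorem continuous_toSobolev {x : ℝ → State} (hx : Continuous x)
    (h : ∀ t, IsCompatible t (x t)) : Continuous fun t => (x t).toSobolev t := by
  have h1 := continuous_slope continuous_id hx
  refine Sobolev.continuous_of_coord fun i => ?_
  refine Fin.cases ?_ (fun i => ?_) i
  · have : (fun t => ((x t).toSobolev t).1 0) = fun t => (x t).1.1 0 :=
      funext fun t => (h t).toL2_toSobolev
    rw [this]
    exact (Sobolev.proj 1 0).continuous.comp hx.fst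
  · have : (fun t => ((x t).toSobolev t).1 i.succ) = fun t => (slope t (x t)).1 i :=
      funext fun t => by rw [← (h t).dx_toSobolev]; rfl
    rw [this]
    exact (Sobolev.proj 1 i).continuous.comp h1

/-- The state at time `t` with given position and velocity. -/
def State.mk' (t : ℝ) (w : Sobolev 2) (v : Sobolev 1) : State :=
  (incl w, Sobolev.transl (-t) (v + dx w), Sobolev.transl t (v - dx w))

theorem velocity_mk' (t : ℝ) (w : Sobolev 2) (v : Sobolev 1) :
    velocity t (State.mk' t w v) = v := by
  rw [velocity_apply, State.mk']
  simp only [Sobolev.transl_transl_neg, Sobolev.transl_neg_transl]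
  module

theorem slope_mk' (t : ℝ) (w : Sobolev 2) (v : Sobolev 1) :
    slope t (State.mk' t w v) = dx w := by
  rw [slope_apply, State.mk']
  simp only [Sobolev.transl_transl_neg, Sobolev.transl_neg_transl]
  module

theorem isCompatible_mk' (t : ℝ) (w : Sobolev 2) (v : Sobolev 1) :
    IsCompatible t (State.mk' t w v) := by
  unfold IsCompatible
  rw [slope_mk']
  rfl

theorem toSobolev_mk' (t : ℝ) (w : Sobolev 2) (v : Sobolev 1) :
    (State.mk' t w v).toSobolev t = w :=
  Sobolev.ext_toL2 (isCompatible_mk' t w v).toL2_toSobolev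

theorem State.mk'_zero (t : ℝ) (g : Sobolev 1) : State.mk' t 0 g = impulse t g := by
  have e1 : incl (0 : Sobolev 2) = 0 := rfl
  have e2 : dx (0 : Sobolev 2) = 0 := rfl
  simp [State.mk', impulse_apply, e1, e2]

/-- `x` solves the first order system with forcing `g`. -/
def IsForcedSolution (μ : ℝ) (g : ℝ → Sobolev 1) (x : ℝ → State) : Prop :=
  ∀ t, HasDerivAt x (generator μ t (x t) + impulse t (g t)) t

/-- Translation can be differentiated only at the cost of one spatial derivative, so the moving
invariant is differentiable in time with values in `L²`, not in `H¹`. -/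
theorem hasDerivAt_transl_toL2 {ρ : ℝ → Sobolev 1} {ρ' : Sobolev 1} {t : ℝ}
    (h : HasDerivAt ρ ρ' t) :
    HasDerivAt (fun t => (Sobolev.transl t (ρ t)).1 0)
      ((Sobolev.transl t (ρ t)).1 1 + (Sobolev.transl t ρ').1 0) t := by
  have h1 : HasDerivAt (fun t => (ρ t).1 0) (ρ'.1 0) t :=
    (Sobolev.proj 1 0).hasFDerivAt.comp_hasDerivAt t h
  have := hasDerivWithinAt_family_apply (S := univ)
    (U := fun t => (transl t).toContinuousLinearMap)
    (fun x => continuous_transl continuous_id continuous_const) (B := fun _ => 1)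
    continuous_const (fun t => (transl t).norm_toContinuousLinearMap_le)
    h1.hasDerivWithinAt ((Sobolev.hasWeakDeriv (ρ t)).hasDerivAt t).hasDerivWithinAt
  rwa [hasDerivWithinAt_univ] at this

theorem hasDerivAt_transl_neg_toL2 {ρ : ℝ → Sobolev 1} {ρ' : Sobolev 1} {t : ℝ}
    (h : HasDerivAt ρ ρ' t) :
    HasDerivAt (fun t => (Sobolev.transl (-t) (ρ t)).1 0)
      (-(Sobolev.transl (-t) (ρ t)).1 1 + (Sobolev.transl (-t) ρ').1 0) t := by
  have h1 : HasDerivAt (fun t => (ρ t).1 0) (ρ'.1 0) t :=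
    (Sobolev.proj 1 0).hasFDerivAt.comp_hasDerivAt t h
  have h2 : HasDerivAt (fun r => transl (-r) ((ρ t).1 0)) (-transl (-t) ((ρ t).1 1)) t := by
    have := ((Sobolev.hasWeakDeriv (ρ t)).hasDerivAt (-t)).scomp t (hasDerivAt_neg t)
    exact this.congr_deriv (by simp)
  have := hasDerivWithinAt_family_apply (S := univ)
    (U := fun t => (transl (-t)).toContinuousLinearMap)
    (fun x => continuous_transl continuous_neg continuous_const) (B := fun _ => 1)
    continuous_const (fun t => (transl (-t)).norm_toContinuousLinearMap_le)
    h1.hasDerivWithinAt h2.hasDerivWithinAt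
  rwa [hasDerivWithinAt_univ] at this

namespace IsForcedSolution

variable {μ : ℝ} {g : ℝ → Sobolev 1} {x : ℝ → State}

theorem continuous (h : IsForcedSolution μ g x) : Continuous x :=
  continuous_iff_continuousAt.2 fun t => (h t).continuousAt

theorem hasDerivAt_fst (h : IsForcedSolution μ g x) (t : ℝ) :
    HasDerivAt (fun t => (x t).1) (velocity t (x t)) t := by
  have := (ContinuousLinearMap.fst ℝ (Sobolev 1) (Sobolev 1 × Sobolev 1)).hasFDerivAt.comp_hasDerivAt
    t (h t)
  refine this.congr_deriv ?_
  simp [generator_apply, impulse_apply]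

theorem hasDerivAt_right (h : IsForcedSolution μ g x) (t : ℝ) :
    HasDerivAt (fun t => (Sobolev.transl t (x t).2.1).1 0)
      ((Sobolev.transl t (x t).2.1).1 1 + (g t - damping μ t • velocity t (x t)).1 0) t := by
  have h1 := ((ContinuousLinearMap.fst ℝ (Sobolev 1) (Sobolev 1)).comp
    (ContinuousLinearMap.snd ℝ (Sobolev 1) (Sobolev 1 × Sobolev 1))).hasFDerivAt.comp_hasDerivAt
    t (h t)
  have h2 : HasDerivAt (fun t => (x t).2.1)
      (Sobolev.transl (-t) (g t - damping μ t • velocity t (x t))) t := by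
    refine h1.congr_deriv ?_
    rw [map_sub, map_smul]
    change 0 - damping μ t • Sobolev.transl (-t) (velocity t (x t)) +
      Sobolev.transl (-t) (g t) = _
    abel
  have h3 := hasDerivAt_transl_toL2 h2
  rwa [Sobolev.transl_transl_neg] at h3

theorem hasDerivAt_left (h : IsForcedSolution μ g x) (t : ℝ) :
    HasDerivAt (fun t => (Sobolev.transl (-t) (x t).2.2).1 0)
      (-(Sobolev.transl (-t) (x t).2.2).1 1 + (g t - damping μ t • velocity t (x t)).1 0) t := by
  have h1 := ((ContinuousLinearMap.snd ℝ (Sobolev 1) (Sobolev 1)).comp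
    (ContinuousLinearMap.snd ℝ (Sobolev 1) (Sobolev 1 × Sobolev 1))).hasFDerivAt.comp_hasDerivAt
    t (h t)
  have h2 : HasDerivAt (fun t => (x t).2.2)
      (Sobolev.transl t (g t - damping μ t • velocity t (x t))) t := by
    refine h1.congr_deriv ?_
    rw [map_sub, map_smul]
    change 0 - damping μ t • Sobolev.transl t (velocity t (x t)) +
      Sobolev.transl t (g t) = _
    abel
  have h3 := hasDerivAt_transl_neg_toL2 h2
  rwa [Sobolev.transl_neg_transl] at h3

theorem hasDerivAt_velocity (h : IsForcedSolution μ g x) (t : ℝ) :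
    HasDerivAt (fun t => (velocity t (x t)).1 0)
      ((slope t (x t)).1 1 + (g t - damping μ t • velocity t (x t)).1 0) t := by
  refine (((h.hasDerivAt_right t).add (h.hasDerivAt_left t)).const_smul
    (1 / 2 : ℝ)).congr_deriv ?_
  have e : (slope t (x t)).1 1 = (1 / 2 : ℝ) • ((Sobolev.transl t (x t).2.1).1 1 -
    (Sobolev.transl (-t) (x t).2.2).1 1) := rfl
  rw [e]
  module

theorem hasDerivAt_slope (h : IsForcedSolution μ g x) (t : ℝ) :
    HasDerivAt (fun t => (slope t (x t)).1 0) ((velocity t (x t)).1 1) t := by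
  refine (((h.hasDerivAt_right t).sub (h.hasDerivAt_left t)).const_smul
    (1 / 2 : ℝ)).congr_deriv ?_
  have e : (velocity t (x t)).1 1 = (1 / 2 : ℝ) • ((Sobolev.transl t (x t).2.1).1 1 +
    (Sobolev.transl (-t) (x t).2.2).1 1) := rfl
  rw [e]
  module

/-- In `L²`, both `∂ₓw` and the slope have time derivative `∂ₓv`, so their difference is constant
and vanishes at all times once it does at `s`. -/
theorem isCompatible (h : IsForcedSolution μ g x) {s : ℝ} (hs : IsCompatible s (x s)) (t : ℝ) :
    IsCompatible t (x t) := by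
  have hd : ∀ t, HasDerivAt (fun t => (x t).1.1 1 - (slope t (x t)).1 0) 0 t := fun t => by
    have h1 : HasDerivAt (fun t => (x t).1.1 1) ((velocity t (x t)).1 1) t :=
      (Sobolev.proj 1 1).hasFDerivAt.comp_hasDerivAt t (h.hasDerivAt_fst t)
    exact (h1.sub (h.hasDerivAt_slope t)).congr_deriv (sub_self _)
  have := is_const_of_deriv_eq_zero (fun t => (hd t).differentiableAt)
    (fun t => (hd t).deriv) t s
  exact sub_eq_zero.1 (this.trans (sub_eq_zero.2 hs))

theorem hasDerivAt_incl (h : IsForcedSolution μ g x) (hc : ∀ t, IsCompatible t (x t)) (t : ℝ) :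
    HasDerivAt (fun t => incl ((x t).toSobolev t)) (velocity t (x t)) t := by
  simp only [fun t => (hc t).incl_toSobolev]
  exact h.hasDerivAt_fst t

theorem hasDerivAt_toL2 (h : IsForcedSolution μ g x) (hc : ∀ t, IsCompatible t (x t)) (t : ℝ) :
    HasDerivAt (fun t => toL2 ((x t).toSobolev t)) (toL2 (velocity t (x t))) t :=
  (Sobolev.proj 1 0).hasFDerivAt.comp_hasDerivAt t (h.hasDerivAt_incl hc t)

theorem hasDerivAt_toL2_velocity (h : IsForcedSolution μ g x) (hc : ∀ t, IsCompatible t (x t))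
    (t : ℝ) : HasDerivAt (fun t => toL2 (velocity t (x t)))
      (toL2 (dx (dx ((x t).toSobolev t))) - damping μ t • toL2 (velocity t (x t)) + toL2 (g t))
      t := by
  refine (h.hasDerivAt_velocity t).congr_deriv ?_
  have e2 : toL2 (dx (dx ((x t).toSobolev t))) = (dx ((x t).toSobolev t)).1 1 := rfl
  have e3 : (g t - damping μ t • velocity t (x t)).1 0 =
    toL2 (g t) - damping μ t • toL2 (velocity t (x t)) := rfl
  rw [e2, (hc t).dx_toSobolev, e3]
  abel

end IsForcedSolution

/-! ### Strong solutions and the operators `R` and `S`. -/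

theorem IsStrongSolution.isLinearSolution {μ s : ℝ} {w₀ : Sobolev 2} {w₁ : Sobolev 1}
    {w : ℝ → Sobolev 2} (h : IsStrongSolution μ s w₀ w₁ w) :
    IsLinearSolution μ s w fun t => derivWithin (fun t => incl (w t)) (Ici s) t := by
  have hd : ∀ t ∈ Ici s, HasDerivWithinAt (fun t => incl (w t))
      (derivWithin (fun t => incl (w t)) (Ici s) t) (Ici s) t := fun t ht =>
    ((h.contDiffOn_one.differentiableOn one_ne_zero) t ht).hasDerivWithinAt
  have hd2 : ∀ t ∈ Ici s, HasDerivWithinAt (fun t => toL2 (w t))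
      (toL2 (derivWithin (fun t => incl (w t)) (Ici s) t)) (Ici s) t := fun t ht =>
    (Sobolev.proj 1 0).hasFDerivAt.comp_hasDerivWithinAt t (hd t ht)
  have he : EqOn (derivWithin (fun t => toL2 (w t)) (Ici s))
      (fun t => toL2 (derivWithin (fun t => incl (w t)) (Ici s) t)) (Ici s) := fun t ht =>
    (hd2 t ht).derivWithin (uniqueDiffOn_Ici s t ht)
  refine ⟨hd, fun t ht => ?_⟩
  have h1 : DifferentiableOn ℝ (derivWithin (fun t => toL2 (w t)) (Ici s)) (Ici s) :=
    (h.contDiffOn_two.derivWithin (m := 1) (uniqueDiffOn_Ici s) (by norm_num)).differentiableOn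
      one_ne_zero
  have h2 := ((h1 t ht).hasDerivWithinAt).congr (fun y hy => (he hy).symm) (he ht).symm
  refine h2.congr_deriv ?_
  have h3 := h.equation t ht
  rw [iteratedDerivWithin_succ, iteratedDerivWithin_one] at h3
  rw [← sub_eq_zero, ← h3, he ht]
  abel

namespace IsForcedSolution

variable {μ : ℝ} {g : ℝ → Sobolev 1} {x : ℝ → State}

theorem contDiff_incl (h : IsForcedSolution μ g x) (hc : ∀ t, IsCompatible t (x t)) :
    ContDiff ℝ 1 fun t => incl ((x t).toSobolev t) := by
  rw [contDiff_one_iff_deriv]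
  refine ⟨fun t => (h.hasDerivAt_incl hc t).differentiableAt, ?_⟩
  rw [funext fun t => (h.hasDerivAt_incl hc t).deriv]
  exact continuous_velocity continuous_id h.continuous

theorem contDiff_toL2 (h : IsForcedSolution μ g x) (hc : ∀ t, IsCompatible t (x t))
    (hg : Continuous g) : ContDiff ℝ 2 fun t => toL2 ((x t).toSobolev t) := by
  have e : (2 : WithTop ℕ∞) = 1 + 1 := by norm_num
  rw [e, contDiff_succ_iff_deriv]
  refine ⟨fun t => (h.hasDerivAt_toL2 hc t).differentiableAt, by simp, ?_⟩
  rw [funext fun t => (h.hasDerivAt_toL2 hc t).deriv, contDiff_one_iff_deriv]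
  refine ⟨fun t => (h.hasDerivAt_toL2_velocity hc t).differentiableAt, ?_⟩
  rw [funext fun t => (h.hasDerivAt_toL2_velocity hc t).deriv]
  have hv : Continuous fun t => toL2 (velocity t (x t)) :=
    (Sobolev.proj 1 0).continuous.comp (continuous_velocity continuous_id h.continuous)
  have hw : Continuous fun t => toL2 (dx (dx ((x t).toSobolev t))) :=
    (Sobolev.proj 2 2).continuous.comp (continuous_toSobolev h.continuous hc)
  exact (hw.sub ((continuous_damping μ).smul hv)).add ((Sobolev.proj 1 0).continuous.comp hg)

theorem derivWithin_incl (h : IsForcedSolution μ g x) (hc : ∀ t, IsCompatible t (x t))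
    {s t : ℝ} (ht : s ≤ t) :
    derivWithin (fun t => incl ((x t).toSobolev t)) (Ici s) t = velocity t (x t) :=
  (h.hasDerivAt_incl hc t).hasDerivWithinAt.derivWithin (uniqueDiffOn_Ici s t ht)

end IsForcedSolution

section Evolution

variable {μ : ℝ} (hμ : 0 < μ)

/-- The evolution family of the damped wave equation on the state space. -/
def evolution (t s : ℝ) : State →L[ℝ] State := (isGenerator μ hμ).evol t s

theorem isForcedSolution_evolution (s : ℝ) (x : State) :
    IsForcedSolution μ (fun _ => 0) fun t => evolution hμ t s x := fun t => by
  rw [map_zero, add_zero]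
  exact (isGenerator μ hμ).hasDerivAt_evol t s x

theorem isCompatible_evolution {s : ℝ} {x : State} (hx : IsCompatible s x) (t : ℝ) :
    IsCompatible t (evolution hμ t s x) :=
  (isForcedSolution_evolution hμ s x).isCompatible (s := s)
    (by simpa [evolution] using hx) t

theorem continuous_evolution {Z : Type*} [TopologicalSpace Z] {t s : Z → ℝ} {y : Z → State}
    (ht : Continuous t) (hs : Continuous s) (hy : Continuous y) :
    Continuous fun z => evolution hμ (t z) (s z) (y z) :=
  (isGenerator μ hμ).continuous_evol ht hs hy

theorem isStrongSolution_evolution {s : ℝ} (hs : 0 ≤ s) (w₀ : Sobolev 2) (w₁ : Sobolev 1) :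
    IsStrongSolution μ s w₀ w₁
      fun t => (evolution hμ t s (State.mk' s w₀ w₁)).toSobolev t := by
  set x := fun t => evolution hμ t s (State.mk' s w₀ w₁)
  have h : IsForcedSolution μ (fun _ => 0) x := isForcedSolution_evolution hμ s _
  have hc : ∀ t, IsCompatible t (x t) := isCompatible_evolution hμ (isCompatible_mk' s w₀ w₁)
  have hxs : x s = State.mk' s w₀ w₁ := (isGenerator μ hμ).evol_self s _
  have h2 := h.contDiff_toL2 hc continuous_const
  refine ⟨(continuous_toSobolev h.continuous hc).continuousOn, (h.contDiff_incl hc).contDiffOn,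
    h2.contDiffOn, ?_, ?_, fun t ht => ?_⟩
  · change (x s).toSobolev s = w₀
    rw [hxs, toSobolev_mk']
  · rw [h.derivWithin_incl hc le_rfl, hxs, velocity_mk']
  · change s ≤ t at ht
    rw [iteratedDerivWithin_eq_iteratedDeriv (uniqueDiffOn_Ici s) h2.contDiffAt ht,
      iteratedDeriv_succ, iteratedDeriv_one, funext fun t => (h.hasDerivAt_toL2 hc t).deriv,
      (h.hasDerivAt_toL2_velocity hc t).deriv,
      (h.hasDerivAt_toL2 hc t).hasDerivWithinAt.derivWithin (uniqueDiffOn_Ici s t ht),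
      damping_of_nonneg μ (hs.trans ht)]
    have e : toL2 (0 : Sobolev 1) = 0 := rfl
    rw [e]
    abel

/-- The evolution family supplies a strong solution, and uniqueness makes the choice in the
definition of `R` immaterial. -/
theorem R_eq {t s : ℝ} (hs : 0 ≤ s) (ht : s ≤ t) (w₀ : Sobolev 2) (w₁ : Sobolev 1) :
    R μ t s w₀ w₁ = (evolution hμ t s (State.mk' s w₀ w₁)).toSobolev t := by
  have h1 := isStrongSolution_evolution hμ hs w₀ w₁
  have hex : ∃ w, IsStrongSolution μ s w₀ w₁ w := ⟨_, h1⟩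
  have h2 := hex.choose_spec
  rw [R, dif_pos hex]
  refine h2.isLinearSolution.unique hμ hs h1.isLinearSolution ?_ ?_ ht
  · rw [h2.initial, h1.initial]
  · rw [h2.initial_deriv, h1.initial_deriv]

theorem incl_R_eq {t s : ℝ} (hs : 0 ≤ s) (ht : s ≤ t) (w₀ : Sobolev 2) (w₁ : Sobolev 1) :
    incl (R μ t s w₀ w₁) = (evolution hμ t s (State.mk' s w₀ w₁)).1 := by
  rw [R_eq hμ hs ht, (isCompatible_evolution hμ (isCompatible_mk' s w₀ w₁) t).incl_toSobolev]

theorem incl_S_eq {t s : ℝ} (hs : 0 ≤ s) (ht : s ≤ t) (g : Sobolev 1) :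
    incl (S μ t s g) = (evolution hμ t s (impulse s g)).1 := by
  rw [S, incl_R_eq hμ hs ht, State.mk'_zero]

/-- The weighted norm of a state at time `t`. -/
def State.decayNorm (t : ℝ) (x : State) : ℝ :=
  (1 + t)⁻¹ * ‖toL2 x.1‖ + ‖slope t x‖ + ‖velocity t x‖

theorem State.decayNorm_mk'_zero (w : Sobolev 2) (v : Sobolev 1) :
    (State.mk' 0 w v).decayNorm 0 = ‖w‖ + ‖v‖ := by
  rw [State.decayNorm, slope_mk', velocity_mk', Sobolev.norm_two_eq, Sobolev.norm_one_eq (dx w)]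
  simp only [add_zero, inv_one, one_mul, ← add_assoc]
  rfl

theorem State.decayNorm_impulse (t : ℝ) (g : Sobolev 1) :
    (impulse t g : State).decayNorm t = ‖g‖ := by
  rw [State.decayNorm, slope_impulse, velocity_impulse]
  have : toL2 (impulse t g).1 = 0 := rfl
  rw [this]
  simp

theorem isCompatible_impulse (t : ℝ) (g : Sobolev 1) : IsCompatible t (impulse t g) := by
  rw [← State.mk'_zero]; exact isCompatible_mk' t 0 g

theorem exists_decayNorm_evolution_le {β : ℝ} (hβ : 0 < β) (hβμ : β ≤ μ) (hβ2 : β ≤ 2)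
    (h3 : 3 * β / 2 < μ + 1) : ∃ K, 0 < K ∧ ∀ (s t : ℝ) (x : State), 0 ≤ s → s ≤ t →
      IsCompatible s x → (evolution hμ t s x).decayNorm t ≤
        K * ((1 + s) / (1 + t)) ^ (β / 2) * x.decayNorm s := by
  obtain ⟨K, hK, h⟩ := IsLinearSolution.exists_decayNorm_le hβ hβμ hβ2 h3
  refine ⟨K, hK, fun s t x hs ht hx => ?_⟩
  have hf := isForcedSolution_evolution hμ s x
  have hc := isCompatible_evolution hμ hx
  have hl : IsLinearSolution μ s (fun t => (evolution hμ t s x).toSobolev t)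
      fun t => velocity t (evolution hμ t s x) := by
    refine ⟨fun t _ => (hf.hasDerivAt_incl hc t).hasDerivWithinAt, fun t ht => ?_⟩
    refine (hf.hasDerivAt_toL2_velocity hc t).hasDerivWithinAt.congr_deriv ?_
    rw [damping_of_nonneg μ (hs.trans ht)]
    exact add_zero _
  have hself : evolution hμ s s x = x := (isGenerator μ hμ).evol_self s x
  have := h s _ _ hs hl t ht
  simp only [DampedWave.decayNorm, (hc t).toL2_toSobolev, (hc t).dx_toSobolev,
    (hc s).toL2_toSobolev, (hc s).dx_toSobolev] at this
  rw [hself] at this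
  exact this

end Evolution

/-! ### Decay of the Duhamel integral. -/

theorem State.decayNorm_add_le {t : ℝ} (ht : 0 ≤ t) (x y : State) :
    (x + y).decayNorm t ≤ x.decayNorm t + y.decayNorm t := by
  have h1 : ‖toL2 (x + y).1‖ ≤ ‖toL2 x.1‖ + ‖toL2 y.1‖ := norm_add_le (toL2 x.1) (toL2 y.1)
  have h2 : ‖slope t (x + y)‖ ≤ ‖slope t x‖ + ‖slope t y‖ := by
    rw [map_add]; exact norm_add_le _ _
  have h3 : ‖velocity t (x + y)‖ ≤ ‖velocity t x‖ + ‖velocity t y‖ := by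
    rw [map_add]; exact norm_add_le _ _
  have h4 := mul_le_mul_of_nonneg_left h1 (by positivity : 0 ≤ (1 + t)⁻¹)
  unfold State.decayNorm
  linarith

theorem State.norm_velocity_le_decayNorm {t : ℝ} (ht : 0 ≤ t) (x : State) :
    ‖velocity t x‖ ≤ x.decayNorm t := by
  unfold State.decayNorm
  have : 0 ≤ (1 + t)⁻¹ * ‖toL2 x.1‖ := by positivity
  linarith [norm_nonneg (slope t x)]

/-- The inclusion of the first component of a state in `L²(ℝ)`. -/
def positionL2 : State →L[ℝ] L2 := Sobolev.proj 1 0 ∘L ContinuousLinearMap.fst ℝ _ _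

theorem State.continuous_decayNorm (t : ℝ) {y : ℝ → State} (hy : Continuous y) :
    Continuous fun s => (y s).decayNorm t :=
  ((continuous_const.mul (positionL2.continuous.comp hy).norm).add
    ((slope t).continuous.comp hy).norm).add ((velocity t).continuous.comp hy).norm

theorem State.decayNorm_integral_le {t r : ℝ} (ht : 0 ≤ t) (hr : 0 ≤ r) {y : ℝ → State}
    (hy : Continuous y) :
    State.decayNorm t (∫ s in (0 : ℝ)..r, y s) ≤ ∫ s in (0 : ℝ)..r, (y s).decayNorm t := by
  have key : ∀ {Y : Type} [NormedAddCommGroup Y] [NormedSpace ℝ Y] [CompleteSpace Y]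
      (L : State →L[ℝ] Y), ‖L (∫ s in (0 : ℝ)..r, y s)‖ ≤ ∫ s in (0 : ℝ)..r, ‖L (y s)‖ := by
    intro Y _ _ _ L
    rw [← L.intervalIntegral_comp_comm (hy.intervalIntegrable _ _)]
    exact intervalIntegral.norm_integral_le_integral_norm hr
  have c1 : Continuous fun s => ‖positionL2 (y s)‖ := (positionL2.continuous.comp hy).norm
  have c2 : Continuous fun s => ‖slope t (y s)‖ := ((slope t).continuous.comp hy).norm
  have c3 : Continuous fun s => ‖velocity t (y s)‖ := ((velocity t).continuous.comp hy).norm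
  have c4 : Continuous fun s => (1 + t)⁻¹ * ‖positionL2 (y s)‖ := continuous_const.mul c1
  have c5 : Continuous fun s => (1 + t)⁻¹ * ‖positionL2 (y s)‖ + ‖slope t (y s)‖ := c4.add c2
  have e : ∫ s in (0 : ℝ)..r, (y s).decayNorm t =
      (1 + t)⁻¹ * (∫ s in (0 : ℝ)..r, ‖positionL2 (y s)‖) + (∫ s in (0 : ℝ)..r, ‖slope t (y s)‖) +
        ∫ s in (0 : ℝ)..r, ‖velocity t (y s)‖ := by
    rw [← intervalIntegral.integral_const_mul, ← intervalIntegral.integral_add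
      (c4.intervalIntegrable _ _) (c2.intervalIntegrable _ _),
      ← intervalIntegral.integral_add
      (c5.intervalIntegrable _ _) (c3.intervalIntegrable _ _)]
    rfl
  rw [e]
  exact add_le_add (add_le_add (mul_le_mul_of_nonneg_left (key positionL2) (by positivity))
    (key (slope t))) (key (velocity t))

theorem integral_rpow_neg_le {γ : ℝ} (hγ : 1 < γ) {t : ℝ} (ht : 0 ≤ t) :
    ∫ s in (0 : ℝ)..t, (1 + s) ^ (-γ) ≤ 1 / (γ - 1) := by
  have h := intervalIntegral.integral_comp_add_left (a := 0) (b := t) (fun s : ℝ => s ^ (-γ)) 1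
  rw [h, add_zero, integral_rpow (Or.inr ⟨by linarith, by
    rw [uIcc_of_le (by linarith)]
    exact fun h => absurd h.1 (by norm_num)⟩), Real.one_rpow]
  have e : -γ + 1 = -(γ - 1) := by ring
  rw [e, div_neg, ← neg_div, neg_sub]
  refine div_le_div_of_nonneg_right ?_ (by linarith)
  have : 0 ≤ (1 + t) ^ (-(γ - 1)) := by positivity
  linarith

section Forced

variable {μ : ℝ} (hμ : 0 < μ)

/-- The state obtained from initial state `x₀` under the forcing `g`. -/
def forced (x₀ : State) (g : ℝ → Sobolev 1) : ℝ → State :=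
  (isGenerator μ hμ).duhamel x₀ fun s => impulse s (g s)

variable {x₀ : State} {g g' : ℝ → Sobolev 1}

theorem forced_apply (x₀ : State) (g : ℝ → Sobolev 1) (t : ℝ) :
    forced hμ x₀ g t =
      evolution hμ t 0 x₀ + ∫ s in (0 : ℝ)..t, evolution hμ t s (impulse s (g s)) := rfl

theorem forced_zero (x₀ : State) (g : ℝ → Sobolev 1) : forced hμ x₀ g 0 = x₀ :=
  (isGenerator μ hμ).duhamel_zero _ _

theorem isForcedSolution_forced (x₀ : State) (hg : Continuous g) :
    IsForcedSolution μ g (forced hμ x₀ g) :=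
  (isGenerator μ hμ).hasDerivAt_duhamel x₀ (continuous_impulse continuous_id hg)

theorem continuous_evolution_impulse (hg : Continuous g) (t : ℝ) :
    Continuous fun s => evolution hμ t s (impulse s (g s)) :=
  continuous_evolution hμ continuous_const continuous_id (continuous_impulse continuous_id hg)

theorem forced_sub (hg : Continuous g) (hg' : Continuous g') (t : ℝ) :
    forced hμ x₀ g t - forced hμ x₀ g' t = forced hμ 0 (fun s => g s - g' s) t := by
  simp only [forced_apply, map_zero, map_sub]
  rw [intervalIntegral.integral_sub
    ((continuous_evolution_impulse hμ hg t).intervalIntegrable _ _)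
    ((continuous_evolution_impulse hμ hg' t).intervalIntegrable _ _)]
  abel

/-- The growth `(1+s)^(β/2)` lost by starting the linear flow at time `s` cancels the same power in
the bound on `g`. What remains is `(1+t)^(-β/2)` times the integral of `(1+s)^(-γ)`, at most
`1/(γ-1)`. -/
theorem decayNorm_forced_le {β K : ℝ} (hK : 0 < K)
    (H : ∀ (s t : ℝ) (x : State), 0 ≤ s → s ≤ t → IsCompatible s x →
      (evolution hμ t s x).decayNorm t ≤ K * ((1 + s) / (1 + t)) ^ (β / 2) * x.decayNorm s)
    (hx₀ : IsCompatible 0 x₀) (hg : Continuous g) {G γ : ℝ} (hG : 0 ≤ G) (hγ : 1 < γ)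
    (hgb : ∀ s, 0 ≤ s → ‖g s‖ ≤ G * (1 + s) ^ (-(β / 2) - γ)) {t : ℝ} (ht : 0 ≤ t) :
    (forced hμ x₀ g t).decayNorm t ≤
      K * (x₀.decayNorm 0 + G / (γ - 1)) * (1 + t) ^ (-(β / 2)) := by
  have hτ : 0 < 1 + t := by linarith
  rw [forced_apply]
  refine (State.decayNorm_add_le ht _ _).trans ?_
  have h1 := H 0 t x₀ le_rfl ht hx₀
  rw [add_zero, Real.div_rpow zero_le_one hτ.le, Real.one_rpow, one_div,
    ← Real.rpow_neg hτ.le] at h1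
  have hc := continuous_evolution_impulse hμ hg t
  have h2 : State.decayNorm t (∫ s in (0 : ℝ)..t, evolution hμ t s (impulse s (g s))) ≤
      K * (1 + t) ^ (-(β / 2)) * G * (1 / (γ - 1)) := by
    refine (State.decayNorm_integral_le ht ht hc).trans ?_
    refine le_trans ?_ (mul_le_mul_of_nonneg_left (integral_rpow_neg_le hγ ht) (by positivity))
    rw [← intervalIntegral.integral_const_mul]
    have hi : IntervalIntegrable (fun s : ℝ => K * (1 + t) ^ (-(β / 2)) * G * (1 + s) ^ (-γ))
        volume 0 t := by
      refine ContinuousOn.intervalIntegrable ?_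
      refine continuousOn_const.mul (ContinuousOn.rpow_const (by fun_prop) fun s hs => ?_)
      rw [uIcc_of_le ht] at hs
      exact Or.inl (by linarith [hs.1])
    refine intervalIntegral.integral_mono_on ht
      ((State.continuous_decayNorm t hc).intervalIntegrable _ _) hi fun s hs => ?_
    have hσ : 0 < 1 + s := by linarith [hs.1]
    refine (H s t _ hs.1 hs.2 (isCompatible_impulse s _)).trans ?_
    rw [State.decayNorm_impulse]
    calc K * ((1 + s) / (1 + t)) ^ (β / 2) * ‖g s‖
        ≤ K * ((1 + s) / (1 + t)) ^ (β / 2) * (G * (1 + s) ^ (-(β / 2) - γ)) :=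
          mul_le_mul_of_nonneg_left (hgb s hs.1) (by positivity)
      _ = _ := by
        rw [Real.div_rpow hσ.le hτ.le, Real.rpow_neg hτ.le, sub_eq_add_neg, Real.rpow_add hσ,
          Real.rpow_neg hσ.le (β / 2)]
        have : (1 + s) ^ (β / 2) ≠ 0 := by positivity
        field_simp
  calc _ ≤ K * (1 + t) ^ (-(β / 2)) * x₀.decayNorm 0 +
        K * (1 + t) ^ (-(β / 2)) * G * (1 / (γ - 1)) := add_le_add h1 h2
    _ = _ := by ring

theorem fst_forced (u₀ : Sobolev 2) (u₁ : Sobolev 1) (hg : Continuous g) {N : ℝ → Sobolev 1}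
    (hN : ∀ s, 0 ≤ s → N s = g s) {t : ℝ} (ht : 0 ≤ t) :
    IntervalIntegrable (fun s => incl (S μ t s (N s))) volume 0 t ∧
      (forced hμ (State.mk' 0 u₀ u₁) g t).1 =
        incl (R μ t 0 u₀ u₁) + ∫ s in (0 : ℝ)..t, incl (S μ t s (N s)) := by
  have hc := continuous_evolution_impulse hμ hg t
  have e : ∀ s ∈ uIcc 0 t, (evolution hμ t s (impulse s (g s))).1 = incl (S μ t s (N s)) := by
    intro s hs
    rw [uIcc_of_le ht] at hs
    rw [hN s hs.1, incl_S_eq hμ hs.1 hs.2]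
  have hi : IntervalIntegrable (fun s => (evolution hμ t s (impulse s (g s))).1) volume 0 t :=
    hc.fst.intervalIntegrable 0 t
  refine ⟨hi.congr fun s hs => e s (uIoc_subset_uIcc hs), ?_⟩
  have h1 := (ContinuousLinearMap.fst ℝ (Sobolev 1) (Sobolev 1 × Sobolev 1)).intervalIntegral_comp_comm
    (hc.intervalIntegrable (μ := volume) 0 t)
  rw [← intervalIntegral.integral_congr e, incl_R_eq hμ le_rfl ht, forced_apply, Prod.fst_add]
  congr 1
  exact h1.symm

end Forced

/-! ### Global existence and uniqueness for the nonlinear system. -/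

namespace PowerLike

variable {f f' : ℝ → ℝ} {c p : ℝ}

theorem norm_nemytskii_sub_le_weight (h : PowerLike f f' c p) {a b : Sobolev 1} {M D σ β : ℝ}
    (hσ : 0 < σ) (hM : 0 ≤ M) (ha : ‖a‖ ≤ M * σ ^ (-(β / 2)))
    (hb : ‖b‖ ≤ M * σ ^ (-(β / 2))) (hab : ‖a - b‖ ≤ D * σ ^ (-(β / 2))) :
    ‖h.nemytskii a - h.nemytskii b‖ ≤
      3 * c * M ^ (p - 1) * D * σ ^ (-(β / 2) - β * (p - 1) / 2) := by
  have hc := h.pos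
  refine (h.norm_nemytskii_sub_le a b ha hb).trans ?_
  refine (mul_le_mul_of_nonneg_left hab (by positivity)).trans (le_of_eq ?_)
  rw [Real.mul_rpow hM (by positivity), ← Real.rpow_mul hσ.le]
  have e : -(β / 2) - β * (p - 1) / 2 = -(β / 2) * (p - 1) + -(β / 2) := by ring
  rw [e, Real.rpow_add hσ]
  ring

/-- Global solutions of the first order system for small data. -/
theorem exists_global (h : PowerLike f f' c p) {μ : ℝ} (hμ : 0 < μ) {β K : ℝ} (hK : 0 < K)
    (H : ∀ (s t : ℝ) (x : State), 0 ≤ s → s ≤ t → IsCompatible s x →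
      (evolution hμ t s x).decayNorm t ≤ K * ((1 + s) / (1 + t)) ^ (β / 2) * x.decayNorm s)
    (hβp : 1 < β * (p - 1) / 2) :
    ∃ M, 0 < M ∧ ∀ x₀ : State, IsCompatible 0 x₀ → x₀.decayNorm 0 ≤ M / (2 * K) →
      ∃ v : ℝ → Sobolev 1, Continuous v ∧
        (∀ t, 0 ≤ t → v t = velocity t (forced hμ x₀ (fun s => h.nemytskii (v s)) t)) ∧
        ∀ t, 0 ≤ t → (forced hμ x₀ (fun s => h.nemytskii (v s)) t).decayNorm t ≤
          M * (1 + t) ^ (-(β / 2)) := by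
  set γ := β * (p - 1) / 2
  have hc := h.pos
  have hp := h.two_lt
  have hγ : 0 < γ - 1 := by linarith
  -- With `M^(p-1) = B` the Duhamel term contracts by exactly `K · 3c M^(p-1)/(γ-1) = 1/2`, and data
  -- of size `M/(2K)` use the other half of the ball.
  set B := (γ - 1) / (6 * c * K)
  have hB : 0 < B := by positivity
  set M := B ^ (1 / (p - 1))
  have hM : 0 < M := by positivity
  have hMp : M ^ (p - 1) = B := by
    rw [← Real.rpow_mul hB.le, one_div_mul_cancel (by linarith), Real.rpow_one]
  have hhalf : ∀ D, K * (3 * c * M ^ (p - 1) * D / (γ - 1)) = 1 / 2 * D := by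
    intro D
    rw [hMp]
    simp only [B]
    field_simp
    ring
  have hbound : ∀ v : ℝ → Sobolev 1, (∀ t, ‖v t‖ ≤ M * (1 + max t 0) ^ (-(β / 2))) →
      ∀ s, 0 ≤ s → ‖v s‖ ≤ M * (1 + s) ^ (-(β / 2)) := fun v hv s hs => by
    have := hv s
    rwa [max_eq_left hs] at this
  have hsource : ∀ x₀ : State, IsCompatible 0 x₀ → x₀.decayNorm 0 ≤ M / (2 * K) →
      ∀ v : ℝ → Sobolev 1, Continuous v → (∀ t, ‖v t‖ ≤ M * (1 + max t 0) ^ (-(β / 2))) →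
        ∀ t, 0 ≤ t → (forced hμ x₀ (fun s => h.nemytskii (v s)) t).decayNorm t ≤
          M * (1 + t) ^ (-(β / 2)) := by
    intro x₀ hx₀ hsmall v hv hvM t ht
    have h1 := decayNorm_forced_le hμ hK H hx₀ (h.continuous_nemytskii.comp hv)
      (G := 3 * c * M ^ (p - 1) * M) (by positivity) hβp (fun s hs => by
        have hb := hbound v hvM s hs
        have := h.norm_nemytskii_sub_le_weight (a := v s) (b := 0) (by linarith : 0 < 1 + s)
          hM.le hb (by simpa using by positivity) (by simpa using hb)
        rw [h.nemytskii_zero, sub_zero] at this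
        exact this) ht
    refine h1.trans (mul_le_mul_of_nonneg_right ?_ (by positivity))
    rw [mul_add, hhalf]
    have : K * x₀.decayNorm 0 ≤ K * (M / (2 * K)) := mul_le_mul_of_nonneg_left hsmall hK.le
    have e : K * (M / (2 * K)) = M / 2 := by field_simp
    linarith
  refine ⟨M, hM, fun x₀ hx₀ hsmall => ?_⟩
  have hpos : ∀ t : ℝ, 0 < 1 + max t 0 := fun t => by linarith [le_max_right t 0]
  -- The unknown is the velocity alone, since the forcing depends on nothing else. Freezing time at
  -- `max t 0` extends everything continuously to negative times, which play no further role.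
  obtain ⟨v, hv, hvM, hfix⟩ := exists_fixedPoint_of_weight
    (wt := fun t : ℝ => (1 + max t 0) ^ (-(β / 2)))
    (Continuous.rpow_const (by fun_prop) fun t => Or.inl (hpos t).ne')
    (fun t => Real.rpow_pos_of_pos (hpos t) _) hM.le (by norm_num : (0 : ℝ) ≤ 1 / 2)
    (by norm_num)
    (fun (v : ℝ → Sobolev 1) t =>
      velocity (max t 0) (forced hμ x₀ (fun s => h.nemytskii (v s)) (max t 0)))
    (fun v hv _ => by
      have hc : Continuous (forced hμ x₀ fun s => h.nemytskii (v s)) :=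
        (isForcedSolution_forced hμ x₀ (h.continuous_nemytskii.comp hv)).continuous
      have hm : Continuous fun t : ℝ => max t 0 := by fun_prop
      exact continuous_velocity hm (hc.comp hm))
    (fun v hv hvM t => (State.norm_velocity_le_decayNorm (le_max_right t 0) _).trans
      (hsource x₀ hx₀ hsmall v hv hvM _ (le_max_right t 0)))
    (fun v v' hv hv' hvM hvM' D hD hvv t => by
      have ht := le_max_right t 0
      rw [← map_sub, forced_sub hμ (g := fun s => h.nemytskii (v s))
        (g' := fun s => h.nemytskii (v' s)) (h.continuous_nemytskii.comp hv)
        (h.continuous_nemytskii.comp hv')]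
      refine (State.norm_velocity_le_decayNorm ht _).trans ?_
      have h0 : IsCompatible 0 (0 : State) := by
        have := isCompatible_impulse 0 0
        rwa [map_zero] at this
      have h1 := decayNorm_forced_le hμ hK H h0
        ((h.continuous_nemytskii.comp hv).sub (h.continuous_nemytskii.comp hv'))
        (G := 3 * c * M ^ (p - 1) * D) (by positivity) hβp (fun s hs =>
          h.norm_nemytskii_sub_le_weight (by linarith : 0 < 1 + s) hM.le (hbound v hvM s hs)
            (hbound v' hvM' s hs) (by
              have := hvv s
              rwa [max_eq_left hs] at this)) ht
      refine h1.trans (le_of_eq ?_)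
      have e : (0 : State).decayNorm 0 = 0 := by
        have := State.decayNorm_impulse 0 0
        rwa [map_zero, norm_zero] at this
      rw [e, zero_add, hhalf])
  refine ⟨v, hv, fun t ht => ?_, hsource x₀ hx₀ hsmall v hv hvM⟩
  have := congrFun hfix t
  simp only [max_eq_left ht] at this
  exact this.symm

/-- Uniqueness for the first order system with nonlinear forcing. -/
theorem eqOn_of_forced (h : PowerLike f f' c p) {μ : ℝ} (hμ : 0 < μ) {x y : ℝ → State}
    (hx : Continuous x) (hy : Continuous y)
    (hx' : ∀ t, 0 ≤ t →
      HasDerivAt x (generator μ t (x t) + impulse t (h.nemytskii (velocity t (x t)))) t)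
    (hy' : ∀ t, 0 ≤ t →
      HasDerivAt y (generator μ t (y t) + impulse t (h.nemytskii (velocity t (y t)))) t)
    (h0 : x 0 = y 0) : EqOn x y (Ici 0) := by
  intro T hT
  obtain ⟨B₁, hB₁⟩ := isCompact_Icc.exists_bound_of_continuousOn (hx.continuousOn (s := Icc 0 T))
  obtain ⟨B₂, hB₂⟩ := isCompact_Icc.exists_bound_of_continuousOn (hy.continuousOn (s := Icc 0 T))
  -- Both solutions stay in this ball on `[0, T]`, where the superposition operator is Lipschitz; no
  -- smallness is needed.
  set B := max (max B₁ B₂) 0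
  have hB : 0 ≤ B := le_max_right _ _
  have hc := h.pos
  have hL : 0 ≤ (1 + μ) + 3 * c * B ^ (p - 1) := by positivity
  have hvel : ∀ t (a : State), ‖velocity t a‖ ≤ ‖a‖ := fun t a => by
    simpa using (velocity t).le_of_opNorm_le (norm_velocity_le t) a
  have himp : ∀ t (a : Sobolev 1), ‖impulse t a‖ ≤ ‖a‖ := fun t a => by
    simpa using (impulse t).le_of_opNorm_le (norm_impulse_le t) a
  refine ODE_solution_unique_of_mem_Icc_right
    (v := fun t z => generator μ t z + impulse t (h.nemytskii (velocity t z)))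
    (s := fun _ => {z | ‖z‖ ≤ B}) (K := ⟨_, hL⟩) (a := 0) (b := T) (fun t _ => ?_)
    hx.continuousOn (fun t ht => (hx' t ht.1).hasDerivWithinAt)
    (fun t ht => (hB₁ t (Ico_subset_Icc_self ht)).trans
      ((le_max_left B₁ B₂).trans (le_max_left _ _)))
    hy.continuousOn (fun t ht => (hy' t ht.1).hasDerivWithinAt)
    (fun t ht => (hB₂ t (Ico_subset_Icc_self ht)).trans
      ((le_max_right B₁ B₂).trans (le_max_left _ _))) h0 ⟨hT, le_rfl⟩
  refine LipschitzOnWith.of_dist_le_mul fun a ha b hb => ?_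
  change _ ≤ ((1 + μ) + 3 * c * B ^ (p - 1)) * _
  rw [dist_eq_norm, dist_eq_norm, add_sub_add_comm, ← map_sub, ← map_sub, add_mul]
  refine (norm_add_le _ _).trans (add_le_add
    ((generator μ t).le_of_opNorm_le ((isGenerator μ hμ).norm_le t) _) ?_)
  refine (himp t _).trans ?_
  refine (h.norm_nemytskii_sub_le _ _ ((hvel t a).trans ha) ((hvel t b).trans hb)).trans ?_
  rw [← map_sub]
  exact mul_le_mul_of_nonneg_left (hvel t _) (by positivity)

/-- A mild solution is the first component of a solution of the first order system. -/
theorem exists_forced_of_isGlobalMildSolution (h : PowerLike f f' c p) {μ : ℝ} (hμ : 0 < μ)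
    {u₀ : Sobolev 2} {u₁ : Sobolev 1} {u : ℝ → Sobolev 1}
    (hu : IsGlobalMildSolution μ f u₀ u₁ u) :
    ∃ x : ℝ → State, Continuous x ∧ x 0 = State.mk' 0 u₀ u₁ ∧
      (∀ t, 0 ≤ t →
        HasDerivAt x (generator μ t (x t) + impulse t (h.nemytskii (velocity t (x t)))) t) ∧
      ∀ t, 0 ≤ t → u t = (x t).1 := by
  obtain ⟨hu1, -, -, N, hN, hmild⟩ := hu
  have hV : ContinuousOn (derivWithin u (Ici 0)) (Ici 0) :=
    hu1.continuousOn_derivWithin (uniqueDiffOn_Ici 0) le_rfl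
  set g : ℝ → Sobolev 1 := fun s => h.nemytskii (derivWithin u (Ici 0) (max s 0))
  have hg : Continuous g := h.continuous_nemytskii.comp
    (hV.comp_continuous (by fun_prop) fun s => le_max_right s 0)
  -- The forcing is determined by its values almost everywhere, so it agrees with the continuous
  -- forcing `g`.
  have hNg : ∀ s, 0 ≤ s → N s = g s := fun s hs => by
    apply Sobolev.ext_toL2
    apply Lp.ext
    filter_upwards [hN s hs, h.coeFn_nemytskii (derivWithin u (Ici 0) s)] with x h1 h2
    simp only [g, max_eq_left hs]
    rw [h1, h2]
  set x := forced hμ (State.mk' 0 u₀ u₁) g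
  have hx : IsForcedSolution μ g x := isForcedSolution_forced hμ _ hg
  have hux : ∀ t, 0 ≤ t → u t = (x t).1 := fun t ht => by
    rw [(fst_forced hμ u₀ u₁ hg hNg ht).2]
    exact (hmild t ht).2
  refine ⟨x, hx.continuous, forced_zero hμ _ _, fun t ht => ?_, hux⟩
  -- The mild formula identifies `u` with the first component of `x`; differentiating shows that the
  -- forcing is evaluated at the velocity of `x` itself, which closes the ODE.
  have h1 : derivWithin u (Ici 0) t = velocity t (x t) := by
    have he : EqOn u (fun t => (x t).1) (Ici 0) := fun t ht => hux t ht
    rw [derivWithin_congr he (hux t ht)]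
    exact (hx.hasDerivAt_fst t).hasDerivWithinAt.derivWithin (uniqueDiffOn_Ici 0 t ht)
  have h2 := hx t
  simp only [g, max_eq_left ht, h1] at h2
  exact h2

end PowerLike

/-! ### Choice of the decay exponent and conclusion. -/

/-- Away from `μ = 2`, `β = min 2 μ` works and `1 < β(p-1)/2` is the hypothesis on `p`. At `μ = 2`
coercivity requires `β < 2`: taking `β ≥ 2 - η` secures the stated rate, and `β ≥ 1 + 1/(p-1)` gives
`β(p-1) ≥ p > 2`. -/
theorem exists_decay_exponent {μ p η : ℝ} (hμ : 0 < μ) (hp : 1 + 2 / min 2 μ < p)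
    (hη : η ∈ Ioo (0 : ℝ) 2) :
    ∃ β, 0 < β ∧ β ≤ μ ∧ β ≤ 2 ∧ 3 * β / 2 < μ + 1 ∧ 1 < β * (p - 1) / 2 ∧ alpha0 μ η ≤ β := by
  have key : ∀ a : ℝ, 0 < a → 1 + 2 / a < p → 1 < a * (p - 1) / 2 := fun a ha h => by
    have h1 : 2 / a < p - 1 := by linarith
    rw [div_lt_iff₀ ha] at h1
    linarith
  rcases lt_trichotomy μ 2 with h | h | h
  · rw [min_eq_right h.le] at hp
    exact ⟨μ, hμ, le_rfl, h.le, by linarith, key μ hμ hp, by simp [alpha0, h]⟩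
  · subst h
    rw [min_self] at hp
    have hp2 : 2 < p := by linarith
    have h1 : 0 < p - 1 := by linarith
    have h2 : 1 / (p - 1) < 1 := by rw [div_lt_one h1]; linarith
    have h3 : 0 < 1 / (p - 1) := by positivity
    have hlt : max (2 - η) (1 + 1 / (p - 1)) < 2 := max_lt (by linarith [hη.1]) (by linarith)
    refine ⟨max (2 - η) (1 + 1 / (p - 1)), lt_of_lt_of_le (by linarith) (le_max_right _ _),
      hlt.le, hlt.le, by linarith, ?_, by simp [alpha0]⟩
    have h4 := mul_le_mul_of_nonneg_right (le_max_right (2 - η) (1 + 1 / (p - 1))) h1.le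
    have h5 : (1 + 1 / (p - 1)) * (p - 1) = p := by field_simp; ring
    linarith
  · rw [min_eq_left h.le] at hp
    refine ⟨2, by norm_num, h.le, le_rfl, by linarith, key 2 (by norm_num) hp, ?_⟩
    simp [alpha0, not_lt.2 h.le, h.ne']

end DampedWave

end

theorem theorem3p1 (μ p η : ℝ) (hμ : 0 < μ) (hp : 1 + 2 / min 2 μ < p)
    (hη : η ∈ Set.Ioo (0 : ℝ) 2) (f : ℝ → ℝ)
    (hf : f = (fun y => |y| ^ p) ∨ f = (fun y => |y| ^ (p - 1) * y)) :
    ∃ ε₀ : ℝ, 0 < ε₀ ∧ ∃ C : ℝ, 0 < C ∧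
      ∀ (u₀ : DampedWave.Sobolev 2) (u₁ : DampedWave.Sobolev 1), ‖u₀‖ + ‖u₁‖ ≤ ε₀ →
        ∃ u : ℝ → DampedWave.Sobolev 2,
          DampedWave.IsGlobalMildSolution μ f u₀ u₁ (fun t => DampedWave.incl (u t)) ∧
          ContinuousOn u (Set.Ici 0) ∧
          ContDiffOn ℝ 1 (fun t => DampedWave.incl (u t)) (Set.Ici 0) ∧
          ContDiffOn ℝ 2 (fun t => DampedWave.toL2 (u t)) (Set.Ici 0) ∧
          (∀ t : ℝ, 0 ≤ t →
            (1 + t)⁻¹ * ‖DampedWave.toL2 (u t)‖ + ‖DampedWave.dx (u t)‖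
                + ‖derivWithin (fun τ => DampedWave.incl (u τ)) (Set.Ici 0) t‖
              ≤ C * (1 + t) ^ (-(DampedWave.alpha0 μ η) / 2)) ∧
          (∀ v : ℝ → DampedWave.Sobolev 1, DampedWave.IsGlobalMildSolution μ f u₀ u₁ v →
            Set.EqOn v (fun t => DampedWave.incl (u t)) (Set.Ici 0)) := by
  -- Since `min 2 μ ≤ 2`, the hypothesis forces `p > 2`, which makes `f'` locally Lipschitz.
  have hp2 : 2 < p := by
    have h1 : min 2 μ ≤ 2 := min_le_left _ _
    have h2 : 0 < min 2 μ := lt_min two_pos hμ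
    have h3 : 1 ≤ 2 / min 2 μ := by rwa [le_div_iff₀ h2, one_mul]
    linarith
  obtain ⟨f', c, h⟩ := DampedWave.exists_powerLike hp2 hf
  obtain ⟨β, hβ, hβμ, hβ2, h3, hβp, hα⟩ := DampedWave.exists_decay_exponent hμ hp hη
  obtain ⟨K, hK, H⟩ := DampedWave.exists_decayNorm_evolution_le hμ hβ hβμ hβ2 h3
  obtain ⟨M, hM, hex⟩ := h.exists_global hμ hK H hβp
  -- At time zero the weighted norm of the initial state is `‖u₀‖ + ‖u₁‖`, so the threshold of
  -- `exists_global` serves as `ε₀` and the radius of its ball as `C`.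
  refine ⟨M / (2 * K), by positivity, M, hM, fun u₀ u₁ hsmall => ?_⟩
  have hcomp := DampedWave.isCompatible_mk' 0 u₀ u₁
  obtain ⟨v, hv, hvx, hdecay⟩ := hex (DampedWave.State.mk' 0 u₀ u₁) hcomp
    (by rwa [DampedWave.State.decayNorm_mk'_zero])
  have hg : Continuous fun s => h.nemytskii (v s) := h.continuous_nemytskii.comp hv
  set x := DampedWave.forced hμ (DampedWave.State.mk' 0 u₀ u₁) fun s => h.nemytskii (v s)
    with hxdef
  have hx : DampedWave.IsForcedSolution μ (fun s => h.nemytskii (v s)) x :=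
    DampedWave.isForcedSolution_forced hμ _ hg
  have hx0 : x 0 = DampedWave.State.mk' 0 u₀ u₁ := DampedWave.forced_zero hμ _ _
  have hc : ∀ t, DampedWave.IsCompatible t (x t) := hx.isCompatible (s := 0) (by rwa [hx0])
  have hd : ∀ t, 0 ≤ t → derivWithin (fun τ => DampedWave.incl ((x τ).toSobolev τ)) (Ici 0) t =
      DampedWave.velocity t (x t) := fun t ht => hx.derivWithin_incl hc ht
  refine ⟨fun t => (x t).toSobolev t,
    ⟨(hx.contDiff_incl hc).contDiffOn, ?_, ?_, fun s => h.nemytskii (v s), fun s hs => ?_,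
      fun t ht => ?_⟩,
    (DampedWave.continuous_toSobolev hx.continuous hc).continuousOn,
    (hx.contDiff_incl hc).contDiffOn, (hx.contDiff_toL2 hc hg).contDiffOn, fun t ht => ?_,
    fun w hw t ht => ?_⟩
  · simp only [hx0, DampedWave.toSobolev_mk']
  · rw [hd 0 le_rfl, hx0, DampedWave.velocity_mk']
  · rw [hd s hs, ← hvx s hs]
    exact h.coeFn_nemytskii (v s)
  · simp only [(hc t).incl_toSobolev]
    exact DampedWave.fst_forced hμ u₀ u₁ hg (fun _ _ => rfl) ht
  · rw [hd t ht, (hc t).toL2_toSobolev, (hc t).dx_toSobolev]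
    refine (hdecay t ht).trans (mul_le_mul_of_nonneg_left ?_ hM.le)
    -- The decay proved has exponent `β/2`; it implies the stated one because `alpha0 μ η ≤ β` and
    -- `1 + t ≥ 1`.
    exact Real.rpow_le_rpow_of_exponent_le (by linarith) (by linarith)
  · obtain ⟨y, hy, hy0, hy', hwy⟩ := h.exists_forced_of_isGlobalMildSolution hμ hw
    have hx' : ∀ t, 0 ≤ t → HasDerivAt x (DampedWave.generator μ t (x t) +
        DampedWave.impulse t (h.nemytskii (DampedWave.velocity t (x t)))) t := fun t ht => by
      rw [← hvx t ht]
      exact hx t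
    rw [hwy t ht, h.eqOn_of_forced hμ hy hx.continuous hy' hx' (hy0.trans hx0.symm) ht]
    exact (hc t).incl_toSobolev.symm
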